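/- All tensor products are minimal (spatial) tensor products of C$^*$-algebras, and ideals are two-sided. **Definitions.** A *compact quantum group* $\mathcal G$ is a nonzero unital C$^*$-algebra $A$ together with a unital $*$-homomorphism $\Delta:A\to A\otimes A$ such that $(\Delta\otimes\mathrm{id})\Delta=(\mathrm{id}\otimes\Delta)\Delta$ and such that $\Delta(A)(1\otimes A)$ and $\Delta(A)(A\otimes 1)$ each span a dense subspace of $A\otimes A$. It has *bounded counit* if there is a unital $*$-homomorphism $\varepsilon:A\to\mathbb C$ with $(\varepsilon\otimes\mathrm{id})\Delta=\mathrm{id}=(\mathrm{id}\otimes\varepsilon)\Delta$. An *action* of $\mathcal G$ on a compact Hausdorff space $X$ is a unital $*$-homomorphism $\alpha:C(X)\to C(X)\otimes A$ such that $(\alpha\otimes\mathrm{id})\alpha=(\mathrm{id}\otimes\Delta)\alpha$ and $\alpha(C(X))(1\otimes A)$ spans a dense subspace of $C(X)\otimes A$. A *Woronowicz C$^*$-ideal* of $\mathcal G$ is a proper closed ideal $I$ of $A$ such that $(\pi\otimes\pi)\Delta(I)=0$, where $\pi:A\to A/I$ is the quotient map. A *quantum subgroup* $\mathcal H$ of $\mathcal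 G$ is a quotient $A/I_{\mathcal H}$ by a closed ideal with a compact quantum group structure $\Delta_{\mathcal H}$ such that $(\pi_{\mathcal H}\otimes\pi_{\mathcal H})\Delta=\Delta_{\mathcal H}\pi_{\mathcal H}$, where $\pi_{\mathcal H}:A\to A/I_{\mathcal H}$ is the quotient map. Let $Y\subseteq X$. A quantum subgroup $\mathcal H$ *fixes* $Y$ if $(\mathrm{ev}_y\otimes\mathrm{id})(\mathrm{id}\otimes\pi_{\mathcal H})\alpha(f)=f(y)1$ for all $f\in C(X)$ and $y\in Y$. It is *the stabilizer of* $Y$ if it fixes $Y$ and for every quantum subgroup $\mathcal K$ of $\mathcal G$ fixing $Y$ there is a surjective unital $*$-homomorphism $\rho:A/I_{\mathcal H}\to A/I_{\mathcal K}$ with $\rho\,\pi_{\mathcal H}=\pi_{\mathcal K}$ and $(\rho\otimes\rho)\Delta_{\mathcal H}=\Delta_{\mathcal K}\,\rho$. **Theorem.** Let $\mathcal G=(A,\Delta)$ be a compact quantum group with bounded counit, let $\alpha$ be an action of $\mathcal G$ on a compact Hausdorff space $X$, and let $Y\subseteq X$ (for instance $Y=\{x\}$ for a point $x\in X$). Let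 $I_Y$ be the closed ideal of $A$ generated by the elements $(\mathrm{ev}_y\otimes\mathrm{id})\alpha(f)-f(y)1$ with $f\in C(X)$ and $y\in Y$. Then $I_Y$ is a Woronowicz C$^*$-ideal, and $A/I_Y$ carries the structure of a quantum subgroup of $\mathcal G$ that fixes $Y$ and is the stabilizer of $Y$. -/

import Mathlib

open scoped TensorProduct ENNReal

universe u v

noncomputable section

set_option linter.unusedSectionVars false

namespace CompactQuantum

section HilbertTensor

variable (H K L : Type u)
  [NormedAddCommGroup H] [InnerProductSpace ℂ H]
  [NormedAddCommGroup K] [InnerProductSpace ℂ K]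
  [NormedAddCommGroup L] [InnerProductSpace ℂ L]

/-- The Hilbert space tensor product: the completion of the algebraic tensor product for the
inner product `⟪a ⊗ b, c ⊗ d⟫ = ⟪a, c⟫ * ⟪b, d⟫`. -/
def HilbertTensor : Type u := UniformSpace.Completion (H ⊗[ℂ] K)

instance : NormedAddCommGroup (HilbertTensor H K) :=
  inferInstanceAs (NormedAddCommGroup (UniformSpace.Completion (H ⊗[ℂ] K)))

instance : InnerProductSpace ℂ (HilbertTensor H K) :=
  inferInstanceAs (InnerProductSpace ℂ (UniformSpace.Completion (H ⊗[ℂ] K)))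

instance : CompleteSpace (HilbertTensor H K) :=
  inferInstanceAs (CompleteSpace (UniformSpace.Completion (H ⊗[ℂ] K)))

/-- The canonical isometric embedding of the algebraic tensor product. -/
def HilbertTensor.ι : H ⊗[ℂ] K →ₗᵢ[ℂ] HilbertTensor H K :=
  UniformSpace.Completion.toComplₗᵢ (𝕜 := ℂ) (E := H ⊗[ℂ] K)

lemma HilbertTensor.denseRange_ι : DenseRange (HilbertTensor.ι H K) :=
  UniformSpace.Completion.denseRange_coe (α := H ⊗[ℂ] K)

variable {H K L}

/-- The elementary tensor `ξ ⊗ η` in the Hilbert space tensor product. -/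
def HilbertTensor.tmul (ξ : H) (η : K) : HilbertTensor H K := HilbertTensor.ι H K (ξ ⊗ₜ[ℂ] η)

instance [Nontrivial H] [Nontrivial K] : Nontrivial (HilbertTensor H K) := by
  obtain ⟨x, hx⟩ := exists_ne (0 : H)
  obtain ⟨y, hy⟩ := exists_ne (0 : K)
  refine ⟨⟨HilbertTensor.tmul x y, 0, fun h => ?_⟩⟩
  have h1 : ‖HilbertTensor.tmul x y‖ = ‖x‖ * ‖y‖ := by
    rw [HilbertTensor.tmul, LinearIsometry.norm_map, TensorProduct.norm_tmul]
  rw [h, norm_zero] at h1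
  have := mul_pos (norm_pos_iff.2 hx) (norm_pos_iff.2 hy)
  linarith

/-- The operator `S ⊗ T` on the Hilbert space tensor product. -/
def opTensor (S : H →L[ℂ] H) (T : K →L[ℂ] K) : HilbertTensor H K →L[ℂ] HilbertTensor H K :=
  ContinuousLinearMap.completion (TensorProduct.mapL S T)

@[simp] lemma opTensor_ι (S : H →L[ℂ] H) (T : K →L[ℂ] K) (x : H ⊗[ℂ] K) :
    opTensor S T (HilbertTensor.ι H K x) = HilbertTensor.ι H K (TensorProduct.mapL S T x) :=
  ContinuousLinearMap.completion_apply_coe _ _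

lemma opTensor_tmul (S : H →L[ℂ] H) (T : K →L[ℂ] K) (ξ : H) (η : K) :
    opTensor S T (HilbertTensor.tmul ξ η) = HilbertTensor.tmul (S ξ) (T η) :=
  opTensor_ι S T (ξ ⊗ₜ η)

lemma op_ext {S T : HilbertTensor H K →L[ℂ] HilbertTensor H K}
    (h : ∀ x : H ⊗[ℂ] K, S (HilbertTensor.ι H K x) = T (HilbertTensor.ι H K x)) : S = T :=
  ContinuousLinearMap.ext fun x => congrFun
    ((HilbertTensor.denseRange_ι H K).equalizer S.continuous T.continuous (funext h)) x

lemma opTensor_one : opTensor (1 : H →L[ℂ] H) (1 : K →L[ℂ] K) = 1 := by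
  refine op_ext fun x => ?_
  rw [opTensor_ι, ContinuousLinearMap.one_def, ContinuousLinearMap.one_def,
    TensorProduct.mapL_id_id]
  rfl

lemma opTensor_mul (S S' : H →L[ℂ] H) (T T' : K →L[ℂ] K) :
    opTensor (S * S') (T * T') = opTensor S T * opTensor S' T' := by
  refine op_ext fun x => ?_
  rw [mul_apply_eq_comp, opTensor_ι, opTensor_ι, opTensor_ι,
    TensorProduct.mapL_mul]
  rfl

lemma opTensor_add_left (S S' : H →L[ℂ] H) (T : K →L[ℂ] K) :
    opTensor (S + S') T = opTensor S T + opTensor S' T := by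
  refine op_ext fun x => ?_
  rw [add_apply, opTensor_ι, opTensor_ι, opTensor_ι,
    TensorProduct.mapL_add_left, add_apply, map_add]

lemma opTensor_add_right (S : H →L[ℂ] H) (T T' : K →L[ℂ] K) :
    opTensor S (T + T') = opTensor S T + opTensor S T' := by
  refine op_ext fun x => ?_
  rw [add_apply, opTensor_ι, opTensor_ι, opTensor_ι,
    TensorProduct.mapL_add_right, add_apply, map_add]

lemma opTensor_smul_left (c : ℂ) (S : H →L[ℂ] H) (T : K →L[ℂ] K) :
    opTensor (c • S) T = c • opTensor S T := by
  refine op_ext fun x => ?_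
  rw [smul_apply, opTensor_ι, opTensor_ι,
    TensorProduct.mapL_smul_left, smul_apply, map_smul]

lemma opTensor_smul_right (c : ℂ) (S : H →L[ℂ] H) (T : K →L[ℂ] K) :
    opTensor S (c • T) = c • opTensor S T := by
  refine op_ext fun x => ?_
  rw [smul_apply, opTensor_ι, opTensor_ι,
    TensorProduct.mapL_smul_right, smul_apply, map_smul]

lemma norm_opTensor_le (S : H →L[ℂ] H) (T : K →L[ℂ] K) : ‖opTensor S T‖ ≤ ‖S‖ * ‖T‖ := by
  refine ContinuousLinearMap.opNorm_le_bound _ (by positivity) fun x => ?_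
  induction x using (HilbertTensor.denseRange_ι H K).induction_on with
  | hp => exact isClosed_le (by fun_prop) (by fun_prop)
  | ih a =>
    rw [opTensor_ι, LinearIsometry.norm_map, LinearIsometry.norm_map]
    exact ((TensorProduct.mapL S T).le_opNorm a).trans
      (mul_le_mul_of_nonneg_right (TensorProduct.norm_mapL_le S T) (norm_nonneg _))

lemma inner_opTensor [CompleteSpace H] [CompleteSpace K] (S : H →L[ℂ] H) (T : K →L[ℂ] K)
    (x y : H ⊗[ℂ] K) :
    inner ℂ (TensorProduct.mapL (star S) (star T) x) y = inner ℂ x (TensorProduct.mapL S T y) := by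
  induction x with
  | zero => simp
  | add a b ha hb => simp only [map_add, inner_add_left, ha, hb]
  | tmul a b =>
    induction y with
    | zero => simp
    | add c d hc hd => simp only [map_add, inner_add_right, hc, hd]
    | tmul c d =>
      rw [TensorProduct.mapL_tmul, TensorProduct.mapL_tmul, TensorProduct.inner_tmul,
        TensorProduct.inner_tmul, ContinuousLinearMap.star_eq_adjoint,
        ContinuousLinearMap.star_eq_adjoint, ContinuousLinearMap.adjoint_inner_left,
        ContinuousLinearMap.adjoint_inner_left]

lemma opTensor_star [CompleteSpace H] [CompleteSpace K] (S : H →L[ℂ] H) (T : K →L[ℂ] K) :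
    opTensor (star S) (star T) = star (opTensor S T) := by
  rw [ContinuousLinearMap.star_eq_adjoint (A := opTensor S T)]
  refine (ContinuousLinearMap.eq_adjoint_iff _ _).mpr fun x y => ?_
  induction x, y using (HilbertTensor.denseRange_ι H K).induction_on₂ with
  | hp => apply isClosed_eq <;> fun_prop
  | h x y =>
    rw [opTensor_ι, opTensor_ι, LinearIsometry.inner_map_map, LinearIsometry.inner_map_map]
    exact inner_opTensor S T x y

lemma denseRange_rTensor_ι : DenseRange ((HilbertTensor.ι H K).rTensor L) := by
  intro z
  set S : Submodule ℂ (HilbertTensor H K ⊗[ℂ] L) :=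
    (LinearMap.range ((HilbertTensor.ι H K).rTensor L).toLinearMap).topologicalClosure with hS
  suffices h : S = ⊤ by
    have hz : z ∈ S := h ▸ Submodule.mem_top
    exact hz
  rw [eq_top_iff, ← TensorProduct.span_tmul_eq_top, Submodule.span_le]
  rintro _ ⟨x, l, rfl⟩
  induction x using (HilbertTensor.denseRange_ι H K).induction_on with
  | hp =>
    exact (Submodule.isClosed_topologicalClosure _).preimage
      (TensorProduct.continuous_tmul.comp (Continuous.prodMk continuous_id continuous_const))
  | ih a => exact Submodule.le_topologicalClosure _ ⟨a ⊗ₜ l, rfl⟩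

lemma denseRange_lTensor_ι : DenseRange ((HilbertTensor.ι K L).lTensor H) := by
  intro z
  set S : Submodule ℂ (H ⊗[ℂ] HilbertTensor K L) :=
    (LinearMap.range ((HilbertTensor.ι K L).lTensor H).toLinearMap).topologicalClosure with hS
  suffices h : S = ⊤ by
    have hz : z ∈ S := h ▸ Submodule.mem_top
    exact hz
  rw [eq_top_iff, ← TensorProduct.span_tmul_eq_top, Submodule.span_le]
  rintro _ ⟨l, x, rfl⟩
  induction x using (HilbertTensor.denseRange_ι K L).induction_on with
  | hp =>
    exact (Submodule.isClosed_topologicalClosure _).preimage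
      (TensorProduct.continuous_tmul.comp (Continuous.prodMk continuous_const continuous_id))
  | ih a => exact Submodule.le_topologicalClosure _ ⟨l ⊗ₜ a, rfl⟩

/-- The canonical unitary `(H ⊗ K) ⊗ L ≃ H ⊗ (K ⊗ L)`, the continuous extension of the associator
of the algebraic tensor product. -/
def hilbertAssoc :
    HilbertTensor (HilbertTensor H K) L ≃ₗᵢ[ℂ] HilbertTensor H (HilbertTensor K L) :=
  (TensorProduct.assoc ℂ H K L).extendOfIsometry
    ((HilbertTensor.ι (HilbertTensor H K) L).comp ((HilbertTensor.ι H K).rTensor L)).toLinearMap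
    ((HilbertTensor.ι H (HilbertTensor K L)).comp ((HilbertTensor.ι K L).lTensor H)).toLinearMap
    ((HilbertTensor.denseRange_ι _ _).comp denseRange_rTensor_ι (HilbertTensor.ι _ _).continuous)
    ((HilbertTensor.denseRange_ι _ _).comp denseRange_lTensor_ι (HilbertTensor.ι _ _).continuous)
    fun x => by
      change ‖HilbertTensor.ι H (HilbertTensor K L) ((HilbertTensor.ι K L).lTensor H
        (TensorProduct.assoc ℂ H K L x))‖ =
        ‖HilbertTensor.ι (HilbertTensor H K) L ((HilbertTensor.ι H K).rTensor L x)‖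
      rw [LinearIsometry.norm_map, LinearIsometry.norm_map, LinearIsometry.norm_map,
        LinearIsometry.norm_map]
      exact (TensorProduct.assocIsometry ℂ H K L).norm_map x

lemma hilbertAssoc_tmul (ξ : H) (η : K) (ζ : L) :
    hilbertAssoc (HilbertTensor.tmul (HilbertTensor.tmul ξ η) ζ) =
      HilbertTensor.tmul ξ (HilbertTensor.tmul η ζ) :=
  LinearEquiv.extendOfIsometry_eq (TensorProduct.assoc ℂ H K L) _ _ _ _ _ ((ξ ⊗ₜ η) ⊗ₜ ζ)

lemma op_ext_tmul {M : Type*} [NormedAddCommGroup M] [NormedSpace ℂ M]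
    {S T : HilbertTensor H K →L[ℂ] M}
    (h : ∀ ξ η, S (HilbertTensor.tmul ξ η) = T (HilbertTensor.tmul ξ η)) : S = T := by
  refine ContinuousLinearMap.ext fun x => congrFun
    ((HilbertTensor.denseRange_ι H K).equalizer S.continuous T.continuous (funext fun y => ?_)) x
  induction y with
  | zero => simp
  | add a b ha hb => simpa using congrArg₂ (· + ·) ha hb
  | tmul a b => exact h a b

lemma conj_hilbertAssoc_opTensor [CompleteSpace H] [CompleteSpace K] [CompleteSpace L]
    (S : H →L[ℂ] H) (T : K →L[ℂ] K) (R : L →L[ℂ] L) :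
    hilbertAssoc.conjStarAlgEquiv (opTensor (opTensor S T) R) = opTensor S (opTensor T R) := by
  set U : HilbertTensor (HilbertTensor H K) L →L[ℂ] HilbertTensor H (HilbertTensor K L) :=
    (hilbertAssoc (H := H) (K := K) (L := L)).toContinuousLinearEquiv.toContinuousLinearMap with hU
  have hU' : ∀ ξ η ζ, U (HilbertTensor.tmul (HilbertTensor.tmul ξ η) ζ) =
      HilbertTensor.tmul ξ (HilbertTensor.tmul η ζ) := hilbertAssoc_tmul
  have h : U ∘L opTensor (opTensor S T) R = opTensor S (opTensor T R) ∘L U := by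
    refine op_ext_tmul fun x ζ => ?_
    let τ : L → HilbertTensor H K →L[ℂ] HilbertTensor (HilbertTensor H K) L := fun z =>
      (HilbertTensor.ι (HilbertTensor H K) L).toContinuousLinearMap ∘L
        (TensorProduct.mkL ℂ (HilbertTensor H K) L).flip z
    have hτ : ∀ z y, τ z y = HilbertTensor.tmul y z := fun z y => rfl
    have h2 : U ∘L opTensor (opTensor S T) R ∘L τ ζ =
        opTensor S (opTensor T R) ∘L U ∘L τ ζ := by
      refine op_ext_tmul fun ξ η => ?_
      simp only [ContinuousLinearMap.comp_apply, hτ, opTensor_tmul, hU']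
    exact DFunLike.congr_fun h2 x
  ext x
  have h3 := DFunLike.congr_fun h (hilbertAssoc.symm x)
  simp only [ContinuousLinearMap.comp_apply] at h3
  refine h3.trans (congrArg _ ?_)
  exact hilbertAssoc.apply_symm_apply x

end HilbertTensor

section TensorRep

variable {A B : Type v} [Ring A] [Algebra ℂ A] [StarRing A] [StarModule ℂ A]
  [Ring B] [Algebra ℂ B] [StarRing B] [StarModule ℂ B]
  {H K : Type u}
  [NormedAddCommGroup H] [InnerProductSpace ℂ H] [CompleteSpace H]
  [NormedAddCommGroup K] [InnerProductSpace ℂ K] [CompleteSpace K]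

/-- `S ↦ S ⊗ 1`. -/
def opLeft (H K : Type u)
    [NormedAddCommGroup H] [InnerProductSpace ℂ H] [CompleteSpace H]
    [NormedAddCommGroup K] [InnerProductSpace ℂ K] [CompleteSpace K] :
    (H →L[ℂ] H) →⋆ₐ[ℂ] (HilbertTensor H K →L[ℂ] HilbertTensor H K) where
  toFun S := opTensor S 1
  map_one' := opTensor_one
  map_mul' S S' := by rw [← opTensor_mul, one_mul]
  map_zero' := by rw [← zero_smul ℂ (0 : H →L[ℂ] H), opTensor_smul_left, zero_smul]
  map_add' S S' := opTensor_add_left S S' 1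
  commutes' c := by
    rw [Algebra.algebraMap_eq_smul_one, opTensor_smul_left, opTensor_one,
      Algebra.algebraMap_eq_smul_one]
  map_star' S := by rw [← opTensor_star, star_one]

/-- `T ↦ 1 ⊗ T`. -/
def opRight (H K : Type u)
    [NormedAddCommGroup H] [InnerProductSpace ℂ H] [CompleteSpace H]
    [NormedAddCommGroup K] [InnerProductSpace ℂ K] [CompleteSpace K] :
    (K →L[ℂ] K) →⋆ₐ[ℂ] (HilbertTensor H K →L[ℂ] HilbertTensor H K) where
  toFun T := opTensor 1 T
  map_one' := opTensor_one
  map_mul' S S' := by rw [← opTensor_mul, one_mul]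
  map_zero' := by rw [← zero_smul ℂ (0 : K →L[ℂ] K), opTensor_smul_right, zero_smul]
  map_add' S S' := opTensor_add_right 1 S S'
  commutes' c := by
    rw [Algebra.algebraMap_eq_smul_one, opTensor_smul_right, opTensor_one,
      Algebra.algebraMap_eq_smul_one]
  map_star' S := by rw [← opTensor_star, star_one]

lemma opLeft_mul_opRight (S : H →L[ℂ] H) (T : K →L[ℂ] K) :
    opLeft H K S * opRight H K T = opTensor S T := by
  change opTensor S 1 * opTensor 1 T = _
  rw [← opTensor_mul, mul_one, one_mul]

lemma opRight_mul_opLeft (S : H →L[ℂ] H) (T : K →L[ℂ] K) :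
    opRight H K T * opLeft H K S = opTensor S T := by
  change opTensor 1 T * opTensor S 1 = _
  rw [← opTensor_mul, mul_one, one_mul]

/-- The algebra homomorphism underlying `tensorRep`. -/
def tensorRepAux (π : A →⋆ₐ[ℂ] (H →L[ℂ] H)) (ρ : B →⋆ₐ[ℂ] (K →L[ℂ] K)) :
    A ⊗[ℂ] B →ₐ[ℂ] (HilbertTensor H K →L[ℂ] HilbertTensor H K) :=
  Algebra.TensorProduct.lift ((opLeft H K).comp π).toAlgHom ((opRight H K).comp ρ).toAlgHom
    fun a b => (opLeft_mul_opRight (π a) (ρ b)).trans (opRight_mul_opLeft (π a) (ρ b)).symm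

lemma tensorRepAux_tmul (π : A →⋆ₐ[ℂ] (H →L[ℂ] H)) (ρ : B →⋆ₐ[ℂ] (K →L[ℂ] K)) (a : A) (b : B) :
    tensorRepAux π ρ (a ⊗ₜ b) = opTensor (π a) (ρ b) :=
  opLeft_mul_opRight (π a) (ρ b)

lemma tensorRepAux_star (π : A →⋆ₐ[ℂ] (H →L[ℂ] H)) (ρ : B →⋆ₐ[ℂ] (K →L[ℂ] K)) (t : A ⊗[ℂ] B) :
    tensorRepAux π ρ (star t) = star (tensorRepAux π ρ t) := by
  induction t with
  | zero => rw [star_zero, map_zero, star_zero]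
  | add x y hx hy => rw [star_add, map_add, map_add, star_add, hx, hy]
  | tmul a b =>
    rw [TensorProduct.star_tmul, tensorRepAux_tmul, tensorRepAux_tmul, map_star, map_star,
      opTensor_star]

/-- The representation `π ⊗ ρ` of the algebraic tensor product `A ⊗ B` on the Hilbert space
`H ⊗ K`, with `(π ⊗ ρ)(a ⊗ b) = π a ⊗ ρ b`. -/
def tensorRep (π : A →⋆ₐ[ℂ] (H →L[ℂ] H)) (ρ : B →⋆ₐ[ℂ] (K →L[ℂ] K)) :
    A ⊗[ℂ] B →⋆ₐ[ℂ] (HilbertTensor H K →L[ℂ] HilbertTensor H K) :=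
  { tensorRepAux π ρ with map_star' := tensorRepAux_star π ρ }

@[simp] lemma tensorRep_tmul (π : A →⋆ₐ[ℂ] (H →L[ℂ] H)) (ρ : B →⋆ₐ[ℂ] (K →L[ℂ] K)) (a : A) (b : B) :
    tensorRep π ρ (a ⊗ₜ b) = opTensor (π a) (ρ b) :=
  tensorRepAux_tmul π ρ a b

end TensorRep

section OpFamily

variable {ι : Type v} (E : ι → Type u) [∀ i, NormedAddCommGroup (E i)]
  [∀ i, InnerProductSpace ℂ (E i)] [∀ i, CompleteSpace (E i)] [∀ i, Nontrivial (E i)]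

/-- The C⋆-algebra of all norm-bounded families of operators `T i` on the Hilbert spaces `E i`,
with pointwise operations and the supremum norm. -/
def OpFamily : Type (max u v) := lp (fun i => E i →L[ℂ] E i) ∞

instance : CStarAlgebra (OpFamily E) :=
  { (inferInstance : NormedRing (lp (fun i => E i →L[ℂ] E i) ∞)),
    (inferInstance : StarRing (lp (fun i => E i →L[ℂ] E i) ∞)),
    (inferInstance : CompleteSpace (lp (fun i => E i →L[ℂ] E i) ∞)),
    (inferInstance : CStarRing (lp (fun i => E i →L[ℂ] E i) ∞)),
    (inferInstance : NormedAlgebra ℂ (lp (fun i => E i →L[ℂ] E i) ∞)),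
    (inferInstance : StarModule ℂ (lp (fun i => E i →L[ℂ] E i) ∞)) with }

variable {E}

/-- The `i`-th member of a bounded family. -/
def OpFamily.eval (i : ι) : OpFamily E →⋆ₐ[ℂ] (E i →L[ℂ] E i) where
  toFun T := Subtype.val (p := fun f => f ∈ lp (fun i => E i →L[ℂ] E i) ∞) T i
  map_one' := rfl
  map_mul' _ _ := rfl
  map_zero' := rfl
  map_add' _ _ := rfl
  commutes' _ := rfl
  map_star' _ := rfl

lemma OpFamily.ext {S T : OpFamily E} (h : ∀ i, OpFamily.eval i S = OpFamily.eval i T) : S = T :=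
  Subtype.ext (funext h)

lemma OpFamily.mem_of_eval_eq {M : StarSubalgebra ℂ (OpFamily E)} {S T : OpFamily E} (hS : S ∈ M)
    (h : ∀ i, OpFamily.eval i S = OpFamily.eval i T) : T ∈ M :=
  OpFamily.ext h ▸ hS

/-- A pointwise bounded family of `⋆`-homomorphisms into the `B(E i)`, as one
`⋆`-homomorphism. -/
def OpFamily.lift {D : Type*} [Ring D] [Algebra ℂ D] [Star D]
    (f : ∀ i, D →⋆ₐ[ℂ] (E i →L[ℂ] E i)) (hf : ∀ d, ∃ C : ℝ, ∀ i, ‖f i d‖ ≤ C) :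
    D →⋆ₐ[ℂ] OpFamily E where
  toFun d := (⟨fun i => f i d, memℓp_infty (by
    obtain ⟨C, hC⟩ := hf d
    exact ⟨C, by rintro _ ⟨i, rfl⟩; exact hC i⟩)⟩ : lp (fun i => E i →L[ℂ] E i) ∞)
  map_one' := OpFamily.ext fun i => map_one (f i)
  map_mul' a b := OpFamily.ext fun i => map_mul (f i) a b
  map_zero' := OpFamily.ext fun i => map_zero (f i)
  map_add' a b := OpFamily.ext fun i => map_add (f i) a b
  commutes' c := OpFamily.ext fun i => AlgHomClass.commutes (f i) c
  map_star' a := OpFamily.ext fun i => map_star (f i) a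

@[simp] lemma OpFamily.eval_lift {D : Type*} [Ring D] [Algebra ℂ D] [Star D]
    (f : ∀ i, D →⋆ₐ[ℂ] (E i →L[ℂ] E i)) (hf : ∀ d, ∃ C : ℝ, ∀ i, ‖f i d‖ ≤ C) (i : ι) (d : D) :
    OpFamily.eval i (OpFamily.lift f hf d) = f i d := rfl

end OpFamily

lemma starAlgHom_continuous {F F' : Type*} [CStarAlgebra F] [CStarAlgebra F']
    (g : F →⋆ₐ[ℂ] F') : Continuous g :=
  AddMonoidHomClass.continuous_of_bound g 1 fun x => by
    rw [one_mul]; exact NonUnitalStarAlgHom.norm_apply_le g x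

section Generated

variable {D F : Type*} [Ring D] [Algebra ℂ D] [StarRing D] [StarModule ℂ D] [CStarAlgebra F]

/-- The norm closure of the range of a `⋆`-homomorphism into a C⋆-algebra. -/
def closedRange (f : D →⋆ₐ[ℂ] F) : StarSubalgebra ℂ F := f.range.topologicalClosure

lemma isClosed_closedRange (f : D →⋆ₐ[ℂ] F) : IsClosed (closedRange f : Set F) :=
  StarSubalgebra.isClosed_topologicalClosure _

lemma mem_closedRange (f : D →⋆ₐ[ℂ] F) (d : D) : f d ∈ closedRange f :=
  StarSubalgebra.le_topologicalClosure _ ⟨d, rfl⟩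

/-- The C⋆-algebra obtained by completing a `⋆`-algebra `D` with respect to a `⋆`-homomorphism
`f` into a C⋆-algebra, i.e. for the C⋆-seminorm `d ↦ ‖f d‖`: the norm closure of the range. -/
def Generated (f : D →⋆ₐ[ℂ] F) : Type _ := closedRange f

instance (f : D →⋆ₐ[ℂ] F) : CStarAlgebra (Generated f) :=
  haveI : IsClosed (closedRange f : Set F) := isClosed_closedRange f
  inferInstanceAs (CStarAlgebra (closedRange f))

namespace Generated

/-- The inclusion of the closure of the range. -/
def incl (f : D →⋆ₐ[ℂ] F) : Generated f →⋆ₐ[ℂ] F := (closedRange f).subtype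

/-- The canonical `⋆`-homomorphism from the original `⋆`-algebra. -/
def of (f : D →⋆ₐ[ℂ] F) : D →⋆ₐ[ℂ] Generated f :=
  f.codRestrict (closedRange f) (mem_closedRange f)

@[simp] lemma incl_of (f : D →⋆ₐ[ℂ] F) (d : D) : incl f (of f d) = f d := rfl

lemma incl_injective (f : D →⋆ₐ[ℂ] F) : Function.Injective (incl f) := Subtype.val_injective

lemma isometry_incl (f : D →⋆ₐ[ℂ] F) : Isometry (incl f) := isometry_subtype_coe

lemma norm_of (f : D →⋆ₐ[ℂ] F) (d : D) : ‖of f d‖ = ‖f d‖ := rfl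

lemma denseRange_of (f : D →⋆ₐ[ℂ] F) : DenseRange (of f) := by
  intro x
  refine Metric.mem_closure_iff.2 fun ε hε => ?_
  have hx : incl f x ∈ closure (f.range : Set F) := Subtype.property (p := fun y => y ∈ closedRange f) x
  obtain ⟨_, ⟨d, rfl⟩, hd⟩ := Metric.mem_closure_iff.1 hx ε hε
  exact ⟨of f d, ⟨d, rfl⟩, hd⟩

/-- A `⋆`-homomorphism into `F'` which carries the generators into the closure of the range of
`f'`, as a `⋆`-homomorphism between the generated C⋆-algebras. -/
def map {D' F' : Type*} [Ring D'] [Algebra ℂ D'] [StarRing D'] [StarModule ℂ D'] [CStarAlgebra F']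
    {f : D →⋆ₐ[ℂ] F} {f' : D' →⋆ₐ[ℂ] F'} (g : Generated f →⋆ₐ[ℂ] F')
    (h : ∀ d, g (of f d) ∈ closedRange f') : Generated f →⋆ₐ[ℂ] Generated f' :=
  StarAlgHom.codRestrict g (closedRange f') fun x =>
    (denseRange_of f).induction_on (p := fun x => g x ∈ closedRange f') x
      ((isClosed_closedRange f').preimage (starAlgHom_continuous g)) h

@[simp] lemma incl_map {D' F' : Type*} [Ring D'] [Algebra ℂ D'] [StarRing D'] [StarModule ℂ D']
    [CStarAlgebra F'] {f : D →⋆ₐ[ℂ] F} {f' : D' →⋆ₐ[ℂ] F'} (g : Generated f →⋆ₐ[ℂ] F')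
    (h : ∀ d, g (of f d) ∈ closedRange f') (x : Generated f) :
    incl f' (map g h x) = g x := rfl

end Generated

end Generated

/-- A nonzero (unital) representation of a C⋆-algebra on a Hilbert space. The Hilbert space lies in
the universe of the algebra, which loses nothing: every representation is a direct sum of cyclic
ones, and these are unitarily equivalent to representations on completions of quotients of `A`. -/
structure HilbertRep (A : Type u) [CStarAlgebra A] where
  space : Type u
  [normedAddCommGroup : NormedAddCommGroup space]
  [innerProductSpace : InnerProductSpace ℂ space]
  [completeSpace : CompleteSpace space]
  [nontrivial : Nontrivial space]
  hom : A →⋆ₐ[ℂ] (space →L[ℂ] space)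

namespace HilbertRep

attribute [instance] normedAddCommGroup innerProductSpace completeSpace nontrivial

variable {A B : Type u} [CStarAlgebra A] [CStarAlgebra B]

/-- The pull-back of a representation along a unital `⋆`-homomorphism. -/
def comp (π : HilbertRep B) (f : A →⋆ₐ[ℂ] B) : HilbertRep A where
  space := π.space
  hom := π.hom.comp f

lemma norm_hom_le (π : HilbertRep A) (a : A) : ‖π.hom a‖ ≤ ‖a‖ :=
  NonUnitalStarAlgHom.norm_apply_le π.hom a

end HilbertRep

section MinTensor

variable (A B C D : Type u) [CStarAlgebra A] [CStarAlgebra B] [CStarAlgebra C] [CStarAlgebra D]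

lemma tensorRep_bounded (t : A ⊗[ℂ] B) :
    ∃ M : ℝ, ∀ p : HilbertRep A × HilbertRep B, ‖tensorRep p.1.hom p.2.hom t‖ ≤ M := by
  induction t with
  | zero => exact ⟨0, fun p => by simp⟩
  | add x y hx hy =>
    obtain ⟨M, hM⟩ := hx
    obtain ⟨N, hN⟩ := hy
    exact ⟨M + N, fun p => by
      rw [map_add]; exact (norm_add_le _ _).trans (add_le_add (hM p) (hN p))⟩
  | tmul a b =>
    refine ⟨‖a‖ * ‖b‖, fun p => ?_⟩
    rw [tensorRep_tmul]
    exact (norm_opTensor_le _ _).trans (mul_le_mul (p.1.norm_hom_le a) (p.2.norm_hom_le b)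
      (norm_nonneg _) (norm_nonneg _))

/-- All the representations `π ⊗ ρ` of the algebraic tensor product `A ⊗ B` taken together. The
norm of the image of `t` is the minimal (spatial) C⋆-norm `sup ‖(π ⊗ ρ)(t)‖`. -/
def spatialRep : A ⊗[ℂ] B →⋆ₐ[ℂ]
    OpFamily fun p : HilbertRep A × HilbertRep B => HilbertTensor p.1.space p.2.space :=
  OpFamily.lift (fun p => tensorRep p.1.hom p.2.hom) (tensorRep_bounded A B)

/-- The minimal (spatial) tensor product of two unital C⋆-algebras: the completion of the algebraic
tensor product for the minimal C⋆-norm, realised as the norm closure of the algebraic tensor product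
in the representation `spatialRep`. -/
def MinTensor : Type (u + 1) := Generated (spatialRep A B)

instance : CStarAlgebra (MinTensor A B) :=
  inferInstanceAs (CStarAlgebra (Generated (spatialRep A B)))

namespace MinTensor

/-- The canonical map from the algebraic tensor product. -/
def of : A ⊗[ℂ] B →⋆ₐ[ℂ] MinTensor A B := Generated.of (spatialRep A B)

lemma denseRange_of : DenseRange (of A B) := Generated.denseRange_of (spatialRep A B)

variable {A B C D}

/-- The elementary tensor `a ⊗ b` in the minimal tensor product. -/
def tmul (a : A) (b : B) : MinTensor A B := of A B (a ⊗ₜ b)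

/-- The representation `π ⊗ ρ` of the minimal tensor product. -/
def rep (π : HilbertRep A) (ρ : HilbertRep B) : MinTensor A B →⋆ₐ[ℂ]
    (HilbertTensor π.space ρ.space →L[ℂ] HilbertTensor π.space ρ.space) :=
  (OpFamily.eval (E := fun p : HilbertRep A × HilbertRep B => HilbertTensor p.1.space p.2.space)
    (π, ρ)).comp (Generated.incl (spatialRep A B))

lemma rep_of (π : HilbertRep A) (ρ : HilbertRep B) (t : A ⊗[ℂ] B) :
    rep π ρ (of A B t) = tensorRep π.hom ρ.hom t := rfl

@[simp] lemma rep_tmul (π : HilbertRep A) (ρ : HilbertRep B) (a : A) (b : B) :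
    rep π ρ (tmul a b) = opTensor (π.hom a) (ρ.hom b) :=
  tensorRep_tmul _ _ a b

lemma ext_rep {x y : MinTensor A B} (h : ∀ π ρ, rep π ρ x = rep π ρ y) : x = y :=
  Generated.incl_injective _ (OpFamily.ext fun p => h p.1 p.2)

/-- A `⋆`-homomorphism `A → B ⊗ C` followed by the representation `π ⊗ ρ`. -/
def pullRep (π : HilbertRep B) (ρ : HilbertRep C) (φ : A →⋆ₐ[ℂ] MinTensor B C) : HilbertRep A where
  space := HilbertTensor π.space ρ.space
  hom := (rep π ρ).comp φ

/-- The `⋆`-homomorphism `f ⊗ g` between minimal tensor products: it is determined by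
`(π ⊗ ρ) ∘ (f ⊗ g) = (π ∘ f) ⊗ (ρ ∘ g)` for all representations `π`, `ρ`. -/
def map (f : A →⋆ₐ[ℂ] C) (g : B →⋆ₐ[ℂ] D) : MinTensor A B →⋆ₐ[ℂ] MinTensor C D :=
  Generated.map (f := spatialRep A B) (f' := spatialRep C D)
    (OpFamily.lift
      (E := fun p : HilbertRep C × HilbertRep D => HilbertTensor p.1.space p.2.space)
      (fun p => rep (p.1.comp f) (p.2.comp g))
      (fun x => ⟨‖x‖, fun p => NonUnitalStarAlgHom.norm_apply_le (rep (p.1.comp f) (p.2.comp g)) x⟩))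
    (fun t => by
      induction t with
      | zero => rw [map_zero, map_zero]; exact zero_mem _
      | add x y hx hy => rw [map_add, map_add]; exact add_mem hx hy
      | tmul a b =>
        refine OpFamily.mem_of_eval_eq (mem_closedRange (spatialRep C D) (f a ⊗ₜ g b)) fun p => ?_
        exact (tensorRep_tmul _ _ _ _).trans (rep_tmul (p.1.comp f) (p.2.comp g) a b).symm)

lemma rep_map (f : A →⋆ₐ[ℂ] C) (g : B →⋆ₐ[ℂ] D) (π : HilbertRep C) (ρ : HilbertRep D)
    (x : MinTensor A B) : rep π ρ (map f g x) = rep (π.comp f) (ρ.comp g) x := rfl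

@[simp] lemma map_tmul (f : A →⋆ₐ[ℂ] C) (g : B →⋆ₐ[ℂ] D) (a : A) (b : B) :
    map f g (tmul a b) = tmul (f a) (g b) :=
  ext_rep fun π ρ => by rw [rep_map, rep_tmul, rep_tmul]; rfl

end MinTensor
end MinTensor

section TripleTensor

variable (A B C : Type u) [CStarAlgebra A] [CStarAlgebra B] [CStarAlgebra C]

lemma tensorRep₃_bounded (t : A ⊗[ℂ] (B ⊗[ℂ] C)) :
    ∃ M : ℝ, ∀ p : HilbertRep A × HilbertRep B × HilbertRep C,
      ‖tensorRep p.1.hom (tensorRep p.2.1.hom p.2.2.hom) t‖ ≤ M := by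
  induction t with
  | zero => exact ⟨0, fun p => by rw [map_zero, norm_zero]⟩
  | add x y hx hy =>
    obtain ⟨M, hM⟩ := hx
    obtain ⟨N, hN⟩ := hy
    exact ⟨M + N, fun p => by
      rw [map_add]; exact (norm_add_le _ _).trans (add_le_add (hM p) (hN p))⟩
  | tmul a s =>
    obtain ⟨M, hM⟩ := tensorRep_bounded B C s
    refine ⟨‖a‖ * M, fun p => ?_⟩
    rw [tensorRep_tmul]
    exact (norm_opTensor_le _ _).trans (mul_le_mul (p.1.norm_hom_le a) (hM p.2)
      (norm_nonneg _) (norm_nonneg _))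

/-- All the representations `π ⊗ ρ ⊗ σ` of the algebraic tensor product `A ⊗ B ⊗ C` taken
together; the norm of the image of `t` is its minimal (spatial) C⋆-norm. -/
def spatialRep₃ : A ⊗[ℂ] (B ⊗[ℂ] C) →⋆ₐ[ℂ]
    OpFamily fun p : HilbertRep A × HilbertRep B × HilbertRep C =>
      HilbertTensor p.1.space (HilbertTensor p.2.1.space p.2.2.space) :=
  OpFamily.lift (fun p => tensorRep p.1.hom (tensorRep p.2.1.hom p.2.2.hom))
    (tensorRep₃_bounded A B C)

/-- The minimal (spatial) tensor product `A ⊗ B ⊗ C` of three unital C⋆-algebras. -/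
def MinTensor₃ : Type (u + 1) := Generated (spatialRep₃ A B C)

instance : CStarAlgebra (MinTensor₃ A B C) :=
  inferInstanceAs (CStarAlgebra (Generated (spatialRep₃ A B C)))

namespace MinTensor₃

variable {A B C} {D : Type u} [CStarAlgebra D]

/-- The elementary tensor `a ⊗ b ⊗ c`. -/
def tmul (a : A) (b : B) (c : C) : MinTensor₃ A B C :=
  Generated.of (spatialRep₃ A B C) (a ⊗ₜ (b ⊗ₜ c))

/-- The representation `π ⊗ ρ ⊗ σ` of the triple tensor product. -/
def rep (π : HilbertRep A) (ρ : HilbertRep B) (σ : HilbertRep C) : MinTensor₃ A B C →⋆ₐ[ℂ]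
    (HilbertTensor π.space (HilbertTensor ρ.space σ.space) →L[ℂ]
      HilbertTensor π.space (HilbertTensor ρ.space σ.space)) :=
  (OpFamily.eval (E := fun p : HilbertRep A × HilbertRep B × HilbertRep C =>
    HilbertTensor p.1.space (HilbertTensor p.2.1.space p.2.2.space)) (π, ρ, σ)).comp
    (Generated.incl (spatialRep₃ A B C))

@[simp] lemma rep_tmul (π : HilbertRep A) (ρ : HilbertRep B) (σ : HilbertRep C)
    (a : A) (b : B) (c : C) :
    rep π ρ σ (tmul a b c) = opTensor (π.hom a) (opTensor (ρ.hom b) (σ.hom c)) :=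
  (tensorRep_tmul π.hom (tensorRep ρ.hom σ.hom) a (b ⊗ₜ c)).trans
    (congrArg (opTensor (π.hom a)) (tensorRep_tmul _ _ b c))

lemma ext_rep {x y : MinTensor₃ A B C} (h : ∀ π ρ σ, rep π ρ σ x = rep π ρ σ y) : x = y :=
  Generated.incl_injective _ (OpFamily.ext fun p => h p.1 p.2.1 p.2.2)

/-- Auxiliary: the map `s ↦ 1 ⊗ s`, `B ⊗ C → A ⊗ B ⊗ C`, with values in bounded families. -/
def inrAux : MinTensor B C →⋆ₐ[ℂ] OpFamily fun p : HilbertRep A × HilbertRep B × HilbertRep C =>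
    HilbertTensor p.1.space (HilbertTensor p.2.1.space p.2.2.space) :=
  OpFamily.lift
    (fun p => (opRight p.1.space (HilbertTensor p.2.1.space p.2.2.space)).comp
      (MinTensor.rep p.2.1 p.2.2))
    (fun x => ⟨‖x‖, fun p => NonUnitalStarAlgHom.norm_apply_le
      ((opRight p.1.space (HilbertTensor p.2.1.space p.2.2.space)).comp
      (MinTensor.rep p.2.1 p.2.2)) x⟩)

lemma inrAux_mem (x : MinTensor B C) : inrAux (A := A) x ∈ closedRange (spatialRep₃ A B C) := by
  refine (MinTensor.denseRange_of B C).induction_on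
    (p := fun x => inrAux (A := A) x ∈ closedRange (spatialRep₃ A B C)) x
    ((isClosed_closedRange _).preimage (starAlgHom_continuous _)) fun t => ?_
  refine OpFamily.mem_of_eval_eq (mem_closedRange _ (1 ⊗ₜ t)) fun p => ?_
  refine (tensorRep_tmul p.1.hom (tensorRep p.2.1.hom p.2.2.hom) 1 t).trans ?_
  rw [map_one]
  rfl

/-- Auxiliary: the map `s ↦ s ⊗ 1`, `A ⊗ B → A ⊗ B ⊗ C`, with values in bounded families. -/
def inlAux : MinTensor A B →⋆ₐ[ℂ] OpFamily fun p : HilbertRep A × HilbertRep B × HilbertRep C =>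
    HilbertTensor p.1.space (HilbertTensor p.2.1.space p.2.2.space) :=
  OpFamily.lift
    (fun p => hilbertAssoc.conjStarAlgEquiv.toStarAlgHom.comp
      ((opLeft (HilbertTensor p.1.space p.2.1.space) p.2.2.space).comp
      (MinTensor.rep p.1 p.2.1)))
    (fun x => ⟨‖x‖, fun p => NonUnitalStarAlgHom.norm_apply_le
      (hilbertAssoc.conjStarAlgEquiv.toStarAlgHom.comp
      ((opLeft (HilbertTensor p.1.space p.2.1.space) p.2.2.space).comp
      (MinTensor.rep p.1 p.2.1))) x⟩)

lemma inlAux_mem (x : MinTensor A B) : inlAux (C := C) x ∈ closedRange (spatialRep₃ A B C) := by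
  refine (MinTensor.denseRange_of A B).induction_on
    (p := fun x => inlAux (C := C) x ∈ closedRange (spatialRep₃ A B C)) x
    ((isClosed_closedRange _).preimage (starAlgHom_continuous _)) fun t => ?_
  induction t with
  | zero => rw [map_zero, map_zero]; exact zero_mem _
  | add x y hx hy => rw [map_add, map_add]; exact add_mem hx hy
  | tmul a b =>
    refine OpFamily.mem_of_eval_eq (mem_closedRange _ (a ⊗ₜ (b ⊗ₜ 1))) fun p => ?_
    refine (tensorRep_tmul p.1.hom (tensorRep p.2.1.hom p.2.2.hom) a (b ⊗ₜ 1)).trans ?_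
    rw [tensorRep_tmul, map_one, ← conj_hilbertAssoc_opTensor]
    exact congrArg (fun T => hilbertAssoc.conjStarAlgEquiv (opTensor T 1))
      (MinTensor.rep_tmul p.1 p.2.1 a b).symm

/-- The `⋆`-homomorphism `id ⊗ φ : D ⊗ A → D ⊗ B ⊗ C` for `φ : A → B ⊗ C`: it is determined by
`(δ ⊗ π ⊗ ρ) ∘ (id ⊗ φ) = δ ⊗ ((π ⊗ ρ) ∘ φ)` for all representations `δ`, `π`, `ρ`. -/
def idTensor (D : Type u) [CStarAlgebra D] (φ : A →⋆ₐ[ℂ] MinTensor B C) :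
    MinTensor D A →⋆ₐ[ℂ] MinTensor₃ D B C :=
  Generated.map (f := spatialRep D A) (f' := spatialRep₃ D B C)
    (OpFamily.lift
      (E := fun p : HilbertRep D × HilbertRep B × HilbertRep C =>
        HilbertTensor p.1.space (HilbertTensor p.2.1.space p.2.2.space))
      (fun p => MinTensor.rep p.1 (MinTensor.pullRep p.2.1 p.2.2 φ))
      (fun x => ⟨‖x‖, fun p => NonUnitalStarAlgHom.norm_apply_le
        (MinTensor.rep p.1 (MinTensor.pullRep p.2.1 p.2.2 φ)) x⟩))
    (fun t => by
      induction t with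
      | zero => rw [map_zero, map_zero]; exact zero_mem _
      | add x y hx hy => rw [map_add, map_add]; exact add_mem hx hy
      | tmul d a =>
        refine OpFamily.mem_of_eval_eq (mul_mem (mem_closedRange _ (d ⊗ₜ 1)) (inrAux_mem (φ a))) fun p => ?_
        refine Eq.trans ?_ (MinTensor.rep_tmul p.1 (MinTensor.pullRep p.2.1 p.2.2 φ) d a).symm
        refine Eq.trans ?_ (opLeft_mul_opRight (p.1.hom d) (MinTensor.rep p.2.1 p.2.2 (φ a)))
        refine (map_mul (OpFamily.eval p) _ _).trans (congrArg₂ (· * ·) ?_ rfl)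
        refine (tensorRep_tmul p.1.hom (tensorRep p.2.1.hom p.2.2.hom) d 1).trans ?_
        rw [map_one]
        rfl)

lemma rep_idTensor (φ : A →⋆ₐ[ℂ] MinTensor B C) (δ : HilbertRep D) (π : HilbertRep B)
    (ρ : HilbertRep C) (x : MinTensor D A) :
    rep δ π ρ (idTensor D φ x) = MinTensor.rep δ (MinTensor.pullRep π ρ φ) x := rfl

/-- The `⋆`-homomorphism `φ ⊗ id : A ⊗ D → B ⊗ C ⊗ D` for `φ : A → B ⊗ C`: it is determined by
`(π ⊗ ρ ⊗ δ) ∘ (φ ⊗ id) = ((π ⊗ ρ) ∘ φ) ⊗ δ` for all representations `π`, `ρ`, `δ`, where the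
operators on `(H ⊗ K) ⊗ L` and `H ⊗ (K ⊗ L)` are identified through `hilbertAssoc`. -/
def tensorId (D : Type u) [CStarAlgebra D] (φ : A →⋆ₐ[ℂ] MinTensor B C) :
    MinTensor A D →⋆ₐ[ℂ] MinTensor₃ B C D :=
  Generated.map (f := spatialRep A D) (f' := spatialRep₃ B C D)
    (OpFamily.lift
      (E := fun p : HilbertRep B × HilbertRep C × HilbertRep D =>
        HilbertTensor p.1.space (HilbertTensor p.2.1.space p.2.2.space))
      (fun p => hilbertAssoc.conjStarAlgEquiv.toStarAlgHom.comp
        (MinTensor.rep (MinTensor.pullRep p.1 p.2.1 φ) p.2.2))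
      (fun x => ⟨‖x‖, fun p => NonUnitalStarAlgHom.norm_apply_le
        (hilbertAssoc.conjStarAlgEquiv.toStarAlgHom.comp
        (MinTensor.rep (MinTensor.pullRep p.1 p.2.1 φ) p.2.2)) x⟩))
    (fun t => by
      induction t with
      | zero => rw [map_zero, map_zero]; exact zero_mem _
      | add x y hx hy => rw [map_add, map_add]; exact add_mem hx hy
      | tmul a d =>
        refine OpFamily.mem_of_eval_eq (mul_mem (inlAux_mem (φ a)) (mem_closedRange _ (1 ⊗ₜ (1 ⊗ₜ d)))) fun p => ?_
        refine Eq.trans ?_ (congrArg hilbertAssoc.conjStarAlgEquiv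
          (MinTensor.rep_tmul (MinTensor.pullRep p.1 p.2.1 φ) p.2.2 a d).symm)
        refine Eq.trans ?_ (congrArg hilbertAssoc.conjStarAlgEquiv
          (opLeft_mul_opRight (MinTensor.rep p.1 p.2.1 (φ a)) (p.2.2.hom d)))
        refine Eq.trans ?_ (map_mul hilbertAssoc.conjStarAlgEquiv _ _).symm
        refine (map_mul (OpFamily.eval p) _ _).trans (congrArg₂ (· * ·) rfl ?_)
        refine (tensorRep_tmul p.1.hom (tensorRep p.2.1.hom p.2.2.hom) 1 (1 ⊗ₜ d)).trans ?_
        rw [tensorRep_tmul, map_one, map_one, ← conj_hilbertAssoc_opTensor, opTensor_one]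
        rfl)

lemma rep_tensorId (φ : A →⋆ₐ[ℂ] MinTensor B C) (π : HilbertRep B) (ρ : HilbertRep C)
    (δ : HilbertRep D) (x : MinTensor A D) :
    rep π ρ δ (tensorId D φ x) =
      hilbertAssoc.conjStarAlgEquiv (MinTensor.rep (MinTensor.pullRep π ρ φ) δ x) := rfl

end MinTensor₃
end TripleTensor

section Faithful

open scoped ComplexOrder

variable {A : Type u} [CStarAlgebra A]

lemma im_eq_zero_of_isSelfAdjoint (g : A →L[ℂ] ℂ) (hg : ‖g‖ ≤ 1) (h1 : g 1 = 1) {c : A}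
    (hc : IsSelfAdjoint c) : (g c).im = 0 := by
  have key : ∀ t : ℝ, ((g c).im + t) ^ 2 ≤ ‖c‖ ^ 2 + t ^ 2 := by
    intro t
    set z : ℂ := (t : ℂ) * Complex.I with hz
    have e1 : g (c + z • (1 : A)) = g c + z := by rw [map_add, map_smul, h1, smul_eq_mul, mul_one]
    have e2 : |(g c).im + t| ≤ ‖c + z • (1 : A)‖ := by
      have : (g c + z).im = (g c).im + t := by simp [hz]
      rw [← this, ← e1]
      refine (Complex.abs_im_le_norm _).trans ((g.le_opNorm _).trans ?_)
      exact mul_le_of_le_one_left (norm_nonneg _) hg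
    have e3 : ‖c + z • (1 : A)‖ ^ 2 ≤ ‖c‖ ^ 2 + t ^ 2 := by
      rw [sq, ← CStarRing.norm_star_mul_self]
      have : star (c + z • (1 : A)) * (c + z • (1 : A)) = c * c + ((t ^ 2 : ℝ) : ℂ) • (1 : A) := by
        have hs : star z = -z := by simp [hz]
        rw [star_add, star_smul, hs, star_one, hc.star_eq]
        simp only [add_mul, mul_add, smul_mul_assoc, mul_smul_comm, one_mul, mul_one, smul_smul,
          neg_smul, neg_mul, smul_add, smul_neg]
        have hzz : z * z = -((t ^ 2 : ℝ) : ℂ) := by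
          rw [hz]; push_cast; ring_nf; simp
        rw [hzz, neg_smul]
        abel
      rw [this]
      refine (norm_add_le _ _).trans (add_le_add ?_ ?_)
      · rw [sq]; exact norm_mul_le _ _
      · rw [norm_smul, Complex.norm_real, Real.norm_of_nonneg (sq_nonneg t)]
        refine mul_le_of_le_one_right (sq_nonneg t) ?_
        rcases subsingleton_or_nontrivial A with h | h
        · rw [Subsingleton.elim (1 : A) 0, norm_zero]; exact zero_le_one
        · exact CStarRing.norm_one.le
    rw [← sq_abs]
    exact (pow_le_pow_left₀ (abs_nonneg _) e2 2).trans e3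
  by_contra h
  have := key ((‖c‖ ^ 2 + 1) / (2 * (g c).im))
  have h2 : 2 * (g c).im * ((‖c‖ ^ 2 + 1) / (2 * (g c).im)) = ‖c‖ ^ 2 + 1 := by
    field_simp
  nlinarith [sq_nonneg (g c).im]

/-- Every nonzero element of a C⋆-algebra acts nontrivially in some representation. -/
lemma exists_hilbertRep_ne_zero {a : A} (ha : a ≠ 0) : ∃ π : HilbertRep A, π.hom a ≠ 0 := by
  let : PartialOrder A := CStarAlgebra.spectralOrder A
  have : StarOrderedRing A := CStarAlgebra.spectralOrderedRing A
  set b : A := star a * a with hb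
  have hb0 : b ≠ 0 := CStarRing.star_mul_self_ne_zero_iff a |>.2 ha
  have hbn : IsStarNormal b := (IsSelfAdjoint.star_mul_self a).isStarNormal
  let S := StarAlgebra.elemental ℂ b
  let b' : S := ⟨b, StarAlgebra.elemental.self_mem ℂ b⟩
  have hb' : b' ≠ 0 := fun h => hb0 (congrArg Subtype.val h)
  obtain ⟨χ, hχ⟩ : ∃ χ : WeakDual.characterSpace ℂ S, χ b' ≠ 0 := by
    by_contra hcon
    push Not at hcon
    apply hb'
    apply (gelfandStarTransform S).injective
    rw [map_zero]
    exact ContinuousMap.ext hcon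
  let χ' : StrongDual ℂ S.toSubalgebra.toSubmodule :=
    WeakDual.toStrongDual (χ : WeakDual ℂ S)
  obtain ⟨g, hg, hgn⟩ := exists_extension_norm_eq S.toSubalgebra.toSubmodule χ'
  have hχ1 : ‖χ'‖ ≤ 1 := by
    refine ContinuousLinearMap.opNorm_le_bound _ zero_le_one fun x => ?_
    rw [one_mul]
    exact NonUnitalStarAlgHom.norm_apply_le (A := S) χ x
  have hg1 : g 1 = 1 := (hg (1 : S)).trans (map_one χ)
  have hgb : g b ≠ 0 := fun h => hχ ((hg b').symm.trans h)
  have hgn' : ‖g‖ ≤ 1 := hgn ▸ hχ1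
  let f : A →ₚ[ℂ] ℂ := PositiveLinearMap.mk₀ g.toLinearMap fun c hc => by
    have hsa : IsSelfAdjoint c := IsSelfAdjoint.of_nonneg hc
    have him := im_eq_zero_of_isSelfAdjoint g hgn' hg1 hsa
    have hn : ‖algebraMap ℝ A ‖c‖ - c‖ ≤ ‖c‖ := by
      refine (CStarAlgebra.norm_le_norm_of_nonneg_of_le
        (sub_nonneg.2 hsa.le_algebraMap_norm_self) (sub_le_self _ hc)).trans ?_
      rw [Algebra.algebraMap_eq_smul_one, norm_smul, norm_norm]
      refine mul_le_of_le_one_right (norm_nonneg _) ?_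
      rcases subsingleton_or_nontrivial A with h | h
      · rw [Subsingleton.elim (1 : A) 0, norm_zero]; exact zero_le_one
      · exact CStarRing.norm_one.le
    refine Complex.nonneg_iff.2 ⟨?_, him.symm⟩
    have h1 : g (algebraMap ℝ A ‖c‖ - c) = (‖c‖ : ℂ) - g c := by
      rw [map_sub, Algebra.algebraMap_eq_smul_one]
      rw [← Complex.coe_smul, map_smul, hg1]; simp
    have h2 : ((‖c‖ : ℂ) - g c).re ≤ ‖c‖ := by
      rw [← h1]
      refine (Complex.re_le_norm _).trans ((g.le_opNorm _).trans ?_)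
      exact (mul_le_of_le_one_left (norm_nonneg _) hgn').trans hn
    simp only [Complex.sub_re, Complex.ofReal_re] at h2
    change 0 ≤ (g c).re
    linarith
  have hv : f.gnsStarAlgHom a (f.toPreGNS 1 : f.GNS) = (f.toPreGNS a : f.GNS) := by
    refine (f.gnsNonUnitalStarAlgHom_apply_coe (a := a) (b := f.toPreGNS 1)).trans ?_
    rw [PositiveLinearMap.leftMulMapPreGNS_apply]
    simp
  have hv0 : (f.toPreGNS a : f.GNS) ≠ 0 := by
    intro h
    have h1 : ‖f.toPreGNS a‖ = 0 := by
      rw [← UniformSpace.Completion.norm_coe, h, norm_zero]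
    have h2 := f.preGNS_norm_sq (f.toPreGNS a)
    rw [h1, PositiveLinearMap.ofPreGNS_toPreGNS] at h2
    have h3 : f b = 0 := by simpa using h2.symm
    exact hgb h3
  have : Nontrivial f.GNS := ⟨⟨_, _, hv0⟩⟩
  refine ⟨{ space := f.GNS, hom := f.gnsStarAlgHom }, fun h => hv0 ?_⟩
  rw [← hv]
  have := DFunLike.congr_fun h (f.toPreGNS 1 : f.GNS)
  exact this

end Faithful

section Slice

variable {A B : Type u} [CStarAlgebra A] [CStarAlgebra B]

namespace MinTensor

lemma tmul_mul_tmul (a a' : A) (b b' : B) : tmul a b * tmul a' b' = tmul (a * a') (b * b') := by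
  rw [tmul, tmul, tmul, ← map_mul, Algebra.TensorProduct.tmul_mul_tmul]

lemma star_tmul (a : A) (b : B) : star (tmul a b) = tmul (star a) (star b) := by
  rw [tmul, tmul, ← map_star, TensorProduct.star_tmul]

lemma tmul_smul_one (c : ℂ) : (tmul (c • (1 : A)) (1 : B)) = c • 1 := by
  rw [tmul, ← TensorProduct.smul_tmul', map_smul]
  exact congrArg (c • ·) (map_one (of A B))

variable (A B) in
/-- `a ↦ a ⊗ 1`. -/
def inl : A →⋆ₐ[ℂ] MinTensor A B where
  toFun a := tmul a 1
  map_one' := map_one (of A B)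
  map_mul' a b := by rw [tmul_mul_tmul, mul_one]
  map_zero' := by rw [tmul, TensorProduct.zero_tmul, map_zero]
  map_add' a b := by rw [tmul, tmul, tmul, TensorProduct.add_tmul, map_add]
  commutes' c := by
    rw [Algebra.algebraMap_eq_smul_one, Algebra.algebraMap_eq_smul_one, tmul_smul_one]
  map_star' a := by rw [star_tmul, star_one]

variable (A B) in
/-- `b ↦ 1 ⊗ b`. -/
def inr : B →⋆ₐ[ℂ] MinTensor A B where
  toFun b := tmul 1 b
  map_one' := map_one (of A B)
  map_mul' a b := by rw [tmul_mul_tmul, mul_one]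
  map_zero' := by rw [tmul, TensorProduct.tmul_zero, map_zero]
  map_add' a b := by rw [tmul, tmul, tmul, TensorProduct.tmul_add, map_add]
  commutes' c := by
    rw [Algebra.algebraMap_eq_smul_one, Algebra.algebraMap_eq_smul_one, tmul,
      ← TensorProduct.smul_tmul, ← tmul, tmul_smul_one]
  map_star' a := by rw [star_tmul, star_one]

lemma tmul_ne_zero {a : A} {b : B} (ha : a ≠ 0) (hb : b ≠ 0) : tmul a b ≠ 0 := by
  obtain ⟨π, hπ⟩ := exists_hilbertRep_ne_zero ha
  obtain ⟨ρ, hρ⟩ := exists_hilbertRep_ne_zero hb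
  intro h
  have h1 : opTensor (π.hom a) (ρ.hom b) = 0 := by rw [← rep_tmul, h, map_zero]
  obtain ⟨ξ, hξ⟩ := DFunLike.ne_iff.1 hπ
  obtain ⟨η, hη⟩ := DFunLike.ne_iff.1 hρ
  have h2 := DFunLike.congr_fun h1 (HilbertTensor.tmul ξ η)
  rw [opTensor_tmul] at h2
  have h3 : ‖HilbertTensor.tmul (π.hom a ξ) (ρ.hom b η)‖ = ‖π.hom a ξ‖ * ‖ρ.hom b η‖ := by
    rw [HilbertTensor.tmul, LinearIsometry.norm_map, TensorProduct.norm_tmul]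
  rw [h2] at h3
  have := mul_pos (norm_pos_iff.2 hξ) (norm_pos_iff.2 hη)
  simp only [zero_apply, norm_zero] at h3
  linarith

lemma inl_injective (A : Type u) [CStarAlgebra A] : Function.Injective (inl A A) := by
  refine (injective_iff_map_eq_zero _).2 fun a ha => ?_
  by_contra h
  have : Nontrivial A := ⟨⟨a, 0, h⟩⟩
  exact tmul_ne_zero h one_ne_zero ha

lemma inr_injective (A : Type u) [CStarAlgebra A] : Function.Injective (inr A A) := by
  refine (injective_iff_map_eq_zero _).2 fun a ha => ?_
  by_contra h
  have : Nontrivial A := ⟨⟨a, 0, h⟩⟩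
  exact tmul_ne_zero one_ne_zero h ha

/-- The `⋆`-homomorphism `b ↦ χ b • 1`. -/
def scalarHom (A : Type u) [CStarAlgebra A] (χ : B →⋆ₐ[ℂ] ℂ) : B →⋆ₐ[ℂ] A where
  toFun b := algebraMap ℂ A (χ b)
  map_one' := by rw [map_one, map_one]
  map_mul' a b := by rw [map_mul, map_mul]
  map_zero' := by rw [map_zero, map_zero]
  map_add' a b := by rw [map_add, map_add]
  commutes' c := by rw [AlgHomClass.commutes]; rfl
  map_star' b := by rw [map_star]; exact algebraMap_star_comm (χ b)

lemma map_scalarHom_mem_range_inr (χ : B →⋆ₐ[ℂ] ℂ) (x : MinTensor B A) :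
    map (scalarHom A χ) (StarAlgHom.id ℂ A) x ∈ (inr A A).range := by
  have hcl : IsClosed ((inr A A).range : Set (MinTensor A A)) :=
    (NonUnitalStarAlgHom.isometry (inr A A) (inr_injective A)).isClosedEmbedding.isClosed_range
  refine (denseRange_of B A).induction_on
    (p := fun x => map (scalarHom A χ) (StarAlgHom.id ℂ A) x ∈ (inr A A).range) x
    (hcl.preimage (starAlgHom_continuous _)) fun t => ?_
  induction t with
  | zero => rw [map_zero, map_zero]; exact zero_mem _
  | add x y hx hy => rw [map_add, map_add]; exact add_mem hx hy
  | tmul b a =>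
    refine ⟨χ b • a, ?_⟩
    refine Eq.trans ?_ (map_tmul (scalarHom A χ) (StarAlgHom.id ℂ A) b a).symm
    change tmul 1 (χ b • a) = tmul (algebraMap ℂ A (χ b)) a
    rw [tmul, tmul, ← TensorProduct.smul_tmul, Algebra.algebraMap_eq_smul_one]

lemma map_scalarHom_mem_range_inl (χ : B →⋆ₐ[ℂ] ℂ) (x : MinTensor A B) :
    map (StarAlgHom.id ℂ A) (scalarHom A χ) x ∈ (inl A A).range := by
  have hcl : IsClosed ((inl A A).range : Set (MinTensor A A)) :=
    (NonUnitalStarAlgHom.isometry (inl A A) (inl_injective A)).isClosedEmbedding.isClosed_range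
  refine (denseRange_of A B).induction_on
    (p := fun x => map (StarAlgHom.id ℂ A) (scalarHom A χ) x ∈ (inl A A).range) x
    (hcl.preimage (starAlgHom_continuous _)) fun t => ?_
  induction t with
  | zero => rw [map_zero, map_zero]; exact zero_mem _
  | add x y hx hy => rw [map_add, map_add]; exact add_mem hx hy
  | tmul a b =>
    refine ⟨χ b • a, ?_⟩
    refine Eq.trans ?_ (map_tmul (StarAlgHom.id ℂ A) (scalarHom A χ) a b).symm
    change tmul (χ b • a) 1 = tmul a (algebraMap ℂ A (χ b))
    rw [tmul, tmul, TensorProduct.smul_tmul, Algebra.algebraMap_eq_smul_one]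

/-- The slice map `χ ⊗ id : B ⊗ A → A` of a character `χ` of `B`, the `⋆`-homomorphism with
`(χ ⊗ id)(b ⊗ a) = χ b • a`. Here `A` is identified with the closed subalgebra `1 ⊗ A` of
`A ⊗ A`. -/
def sliceLeft (χ : B →⋆ₐ[ℂ] ℂ) : MinTensor B A →⋆ₐ[ℂ] A :=
  (StarAlgEquiv.ofInjective (inr A A) (inr_injective A)).symm.toStarAlgHom.comp
    ((map (scalarHom A χ) (StarAlgHom.id ℂ A)).codRestrict (inr A A).range
      (map_scalarHom_mem_range_inr χ))

/-- The slice map `id ⊗ χ : A ⊗ B → A` of a character `χ` of `B`, the `⋆`-homomorphism with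
`(id ⊗ χ)(a ⊗ b) = χ b • a`. Here `A` is identified with the closed subalgebra `A ⊗ 1` of
`A ⊗ A`. -/
def sliceRight (χ : B →⋆ₐ[ℂ] ℂ) : MinTensor A B →⋆ₐ[ℂ] A :=
  (StarAlgEquiv.ofInjective (inl A A) (inl_injective A)).symm.toStarAlgHom.comp
    ((map (StarAlgHom.id ℂ A) (scalarHom A χ)).codRestrict (inl A A).range
      (map_scalarHom_mem_range_inl χ))

lemma inr_sliceLeft (χ : B →⋆ₐ[ℂ] ℂ) (x : MinTensor B A) :
    inr A A (sliceLeft χ x) = map (scalarHom A χ) (StarAlgHom.id ℂ A) x :=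
  congrArg Subtype.val ((StarAlgEquiv.ofInjective (inr A A) (inr_injective A)).apply_symm_apply
    ⟨_, map_scalarHom_mem_range_inr χ x⟩)

lemma inl_sliceRight (χ : B →⋆ₐ[ℂ] ℂ) (x : MinTensor A B) :
    inl A A (sliceRight χ x) = map (StarAlgHom.id ℂ A) (scalarHom A χ) x :=
  congrArg Subtype.val ((StarAlgEquiv.ofInjective (inl A A) (inl_injective A)).apply_symm_apply
    ⟨_, map_scalarHom_mem_range_inl χ x⟩)

@[simp] lemma sliceLeft_tmul (χ : B →⋆ₐ[ℂ] ℂ) (b : B) (a : A) :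
    sliceLeft χ (tmul b a) = χ b • a := by
  apply inr_injective A
  rw [inr_sliceLeft, map_tmul]
  change tmul (algebraMap ℂ A (χ b)) a = tmul 1 (χ b • a)
  rw [tmul, tmul, ← TensorProduct.smul_tmul, Algebra.algebraMap_eq_smul_one]

@[simp] lemma sliceRight_tmul (χ : B →⋆ₐ[ℂ] ℂ) (a : A) (b : B) :
    sliceRight χ (tmul a b) = χ b • a := by
  apply inl_injective A
  rw [inl_sliceRight, map_tmul]
  change tmul a (algebraMap ℂ A (χ b)) = tmul (χ b • a) 1
  rw [tmul, tmul, TensorProduct.smul_tmul, Algebra.algebraMap_eq_smul_one]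

end MinTensor

end Slice

/-- A norm-closed two-sided ideal of a C⋆-algebra. -/
structure ClosedIdeal (A : Type u) [CStarAlgebra A] where
  toIdeal : Ideal A
  isTwoSided : toIdeal.IsTwoSided
  isClosed : IsClosed (toIdeal : Set A)

namespace ClosedIdeal

variable {A : Type u} [CStarAlgebra A] (J : ClosedIdeal A)

instance : J.toIdeal.IsTwoSided := J.isTwoSided

instance : IsClosed (J.toIdeal : Set A) := J.isClosed

/-- `e = n u (1 + n u)⁻¹` with `u = i⋆ i` and `n` large. -/
lemma exists_approx {i : A} (hi : i ∈ J.toIdeal) {δ : ℝ} (hδ : 0 < δ) :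
    ∃ e ∈ J.toIdeal, star e = e ∧ ‖1 - e‖ ≤ 1 ∧ ‖i * (1 - e)‖ ≤ δ := by
  set u : A := star i * i with hu
  have husa : IsSelfAdjoint u := IsSelfAdjoint.star_mul_self i
  have hsp : ∀ t ∈ spectrum ℝ u, 0 ≤ t := spectrum_star_mul_self_nonneg
  obtain ⟨n, hn0, hn⟩ : ∃ n : ℝ, 0 < n ∧ 1 / n ≤ δ ^ 2 :=
    ⟨1 / δ ^ 2, by positivity, by rw [one_div_one_div]⟩
  have hpos : ∀ t ∈ spectrum ℝ u, 0 < 1 + n * t := fun t ht => by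
    have := mul_nonneg hn0.le (hsp t ht); linarith
  have hc : ContinuousOn (fun t : ℝ => (1 + n * t)⁻¹) (spectrum ℝ u) :=
    ContinuousOn.inv₀ (by fun_prop) fun t ht => (hpos t ht).ne'
  have hc2 : ContinuousOn (fun t : ℝ => n * (1 + n * t)⁻¹) (spectrum ℝ u) :=
    continuousOn_const.mul hc
  have hc3 : ContinuousOn (fun t : ℝ => t * (n * (1 + n * t)⁻¹)) (spectrum ℝ u) :=
    continuousOn_id.mul hc2
  have hc4 : ContinuousOn (fun t : ℝ => t * (1 + n * t)⁻¹) (spectrum ℝ u) :=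
    continuousOn_id.mul hc
  set r : A := cfc (fun t : ℝ => (1 + n * t)⁻¹) u with hr
  have hrsa : IsSelfAdjoint r := cfc_predicate _ _
  set e : A := u * cfc (fun t : ℝ => n * (1 + n * t)⁻¹) u with he
  have h1e : 1 - e = r := by
    have h1 : e = cfc (fun t : ℝ => t * (n * (1 + n * t)⁻¹)) u := by
      rw [cfc_mul (fun t : ℝ => t) (fun t : ℝ => n * (1 + n * t)⁻¹) u continuousOn_id hc2,
        cfc_id' ℝ u]
    rw [h1, hr, ← cfc_const_one ℝ u, ← cfc_sub _ _ u continuousOn_const hc3]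
    refine cfc_congr fun t ht => ?_
    have h2 : (1 + n * t) * (1 + n * t)⁻¹ = 1 := mul_inv_cancel₀ (hpos t ht).ne'
    linear_combination -h2
  have hue : e ∈ J.toIdeal :=
    Ideal.mul_mem_right _ _ (Ideal.mul_mem_left _ _ hi)
  refine ⟨e, hue, ?_, ?_, ?_⟩
  · have : e = 1 - r := by rw [← h1e]; abel
    rw [this, star_sub, star_one, hrsa.star_eq]
  · rw [h1e]
    refine norm_cfc_le zero_le_one fun t ht => ?_
    have := hpos t ht
    have h0 := mul_nonneg hn0.le (hsp t ht)
    rw [Real.norm_of_nonneg (inv_nonneg.2 this.le)]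
    exact inv_le_one_of_one_le₀ (by linarith)
  · rw [h1e]
    refine (sq_le_sq₀ (norm_nonneg _) hδ.le).1 ?_
    rw [sq, ← CStarRing.norm_star_mul_self]
    have h2 : star (i * r) * (i * r) =
        cfc (fun t : ℝ => (1 + n * t)⁻¹ * (t * (1 + n * t)⁻¹)) u := by
      rw [cfc_mul _ _ u hc hc4,
        cfc_mul (fun t : ℝ => t) _ u continuousOn_id hc, cfc_id' ℝ u, star_mul, hrsa.star_eq, hu]
      simp only [mul_assoc, hr]
      rfl
    rw [h2]
    refine (norm_cfc_le (by positivity) fun t ht => ?_).trans hn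
    have h3 := hpos t ht
    have h4 := hsp t ht
    rw [Real.norm_of_nonneg (by positivity)]
    have h5 : (1 + n * t)⁻¹ * (t * (1 + n * t)⁻¹) = t / (1 + n * t) ^ 2 := by
      field_simp
    rw [h5, div_le_div_iff₀ (by positivity) hn0]
    nlinarith [mul_nonneg hn0.le h4]

/-- Closed two-sided ideals are self-adjoint. -/
lemma star_mem {i : A} (hi : i ∈ J.toIdeal) : star i ∈ J.toIdeal := by
  have : star i ∈ closure (J.toIdeal : Set A) := by
    refine Metric.mem_closure_iff.2 fun ε hε => ?_
    obtain ⟨e, he, hes, -, h2⟩ := J.exists_approx hi (half_pos hε)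
    refine ⟨e * star i, Ideal.mul_mem_right _ _ he, ?_⟩
    have h3 : star i - e * star i = star (i * (1 - e)) := by
      rw [star_mul, star_sub, star_one, hes, sub_mul, one_mul]
    rw [dist_eq_norm, h3, norm_star]
    linarith
  rwa [J.isClosed.closure_eq] at this

/-- The quotient C⋆-algebra `A / J`, with the quotient norm. -/
def Quotient : Type u := A ⧸ J.toIdeal

instance : Ring J.Quotient := inferInstanceAs (Ring (A ⧸ J.toIdeal))

instance : Algebra ℂ J.Quotient := inferInstanceAs (Algebra ℂ (A ⧸ J.toIdeal))

instance : NormedAddCommGroup J.Quotient :=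
  inferInstanceAs (NormedAddCommGroup (A ⧸ (J.toIdeal : Submodule A A)))

instance : CompleteSpace J.Quotient :=
  inferInstanceAs (CompleteSpace (A ⧸ (J.toIdeal : Submodule A A)))

/-- The quotient map, as an algebra homomorphism. -/
def mkₐ : A →ₐ[ℂ] J.Quotient := Ideal.Quotient.mkₐ ℂ J.toIdeal

lemma mkₐ_surjective : Function.Surjective J.mkₐ := Ideal.Quotient.mk_surjective

lemma mkₐ_eq_iff {a b : A} : J.mkₐ a = J.mkₐ b ↔ a - b ∈ J.toIdeal := Ideal.Quotient.eq

lemma norm_mkₐ_le (a : A) : ‖J.mkₐ a‖ ≤ ‖a‖ :=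
  Submodule.Quotient.norm_mk_le (S := J.toIdeal) a

lemma exists_norm_lt (x : J.Quotient) {δ : ℝ} (hδ : 0 < δ) : ∃ a, J.mkₐ a = x ∧ ‖a‖ < ‖x‖ + δ :=
  Submodule.Quotient.norm_mk_lt (S := J.toIdeal) x hδ

instance : NormedRing J.Quotient :=
  { (inferInstance : Ring J.Quotient), (inferInstance : NormedAddCommGroup J.Quotient) with
    norm_mul_le := fun x y => by
      refine le_of_forall_pos_le_add fun ε hε => ?_
      set M : ℝ := ‖x‖ + ‖y‖ + 1 with hM
      have hM0 : 0 < M := by positivity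
      set δ : ℝ := min 1 (ε / M) with hδ
      have hδ0 : 0 < δ := lt_min one_pos (div_pos hε hM0)
      have hδ1 : δ ≤ 1 := min_le_left _ _
      have hδ2 : δ * M ≤ ε := (le_div_iff₀ hM0).1 (min_le_right _ _)
      obtain ⟨a, rfl, ha⟩ := J.exists_norm_lt x hδ0
      obtain ⟨b, rfl, hb⟩ := J.exists_norm_lt y hδ0
      have h1 : ‖J.mkₐ a * J.mkₐ b‖ ≤ ‖a‖ * ‖b‖ := by
        rw [← map_mul]; exact (J.norm_mkₐ_le _).trans (norm_mul_le _ _)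
      have h2 : ‖a‖ * ‖b‖ ≤ (‖J.mkₐ a‖ + δ) * (‖J.mkₐ b‖ + δ) :=
        mul_le_mul ha.le hb.le (norm_nonneg _) (by positivity)
      nlinarith [mul_nonneg hδ0.le (sub_nonneg.2 hδ1)] }

instance : NormedAlgebra ℂ J.Quotient :=
  { (inferInstance : Algebra ℂ J.Quotient) with
    norm_smul_le := fun c x => by
      refine le_of_forall_pos_le_add fun ε hε => ?_
      have hc : 0 < ‖c‖ + 1 := by positivity
      obtain ⟨a, rfl, ha⟩ := J.exists_norm_lt x (div_pos hε hc)
      rw [← map_smul]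
      refine (J.norm_mkₐ_le _).trans ((norm_smul_le c a).trans ?_)
      have h1 : ‖c‖ * ‖a‖ ≤ ‖c‖ * (‖J.mkₐ a‖ + ε / (‖c‖ + 1)) :=
        mul_le_mul_of_nonneg_left ha.le (norm_nonneg _)
      have h2 : ‖c‖ * (ε / (‖c‖ + 1)) ≤ ε := by
        rw [← mul_div_assoc, div_le_iff₀ hc]; nlinarith
      linarith }

/-- The star of the quotient, `(a + J)⋆ = a⋆ + J`. -/
instance : Star J.Quotient := ⟨fun x => J.mkₐ (star (Function.surjInv J.mkₐ_surjective x))⟩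

lemma star_mkₐ (a : A) : star (J.mkₐ a) = J.mkₐ (star a) := by
  refine J.mkₐ_eq_iff.2 ?_
  rw [← star_sub]
  exact J.star_mem (J.mkₐ_eq_iff.1 (Function.surjInv_eq J.mkₐ_surjective (J.mkₐ a)))

instance : StarRing J.Quotient where
  star_involutive x := by
    obtain ⟨a, rfl⟩ := J.mkₐ_surjective x
    rw [star_mkₐ, star_mkₐ, star_star]
  star_mul x y := by
    obtain ⟨a, rfl⟩ := J.mkₐ_surjective x
    obtain ⟨b, rfl⟩ := J.mkₐ_surjective y
    rw [← map_mul, star_mkₐ, star_mkₐ, star_mkₐ, star_mul, map_mul]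
  star_add x y := by
    obtain ⟨a, rfl⟩ := J.mkₐ_surjective x
    obtain ⟨b, rfl⟩ := J.mkₐ_surjective y
    rw [← map_add, star_mkₐ, star_mkₐ, star_mkₐ, star_add, map_add]

instance : StarModule ℂ J.Quotient where
  star_smul c x := by
    obtain ⟨a, rfl⟩ := J.mkₐ_surjective x
    rw [← map_smul, star_mkₐ, star_mkₐ, star_smul, map_smul]

instance : CStarRing J.Quotient where
  norm_mul_self_le x := by
    obtain ⟨a, rfl⟩ := J.mkₐ_surjective x
    rw [star_mkₐ, ← map_mul]
    refine le_of_forall_pos_le_add fun ε hε => ?_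
    obtain ⟨c, hc, hcn⟩ := J.exists_norm_lt (J.mkₐ (star a * a)) (half_pos hε)
    obtain ⟨e, he, hes, h1, h2⟩ := J.exists_approx (J.mkₐ_eq_iff.1 hc) (half_pos hε)
    have h3 : J.mkₐ a = J.mkₐ (a * (1 - e)) := by
      refine J.mkₐ_eq_iff.2 ?_
      rw [mul_sub, mul_one, sub_sub_cancel]
      exact J.toIdeal.mul_mem_left _ he
    have h4 : ‖J.mkₐ a‖ ≤ ‖a * (1 - e)‖ := by rw [h3]; exact J.norm_mkₐ_le _
    have h5 : ‖a * (1 - e)‖ * ‖a * (1 - e)‖ ≤ ‖star a * a * (1 - e)‖ := by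
      rw [← CStarRing.norm_star_mul_self, star_mul, star_sub, star_one, hes, mul_assoc,
        ← mul_assoc (star a)]
      exact (norm_mul_le _ _).trans (mul_le_of_le_one_left (norm_nonneg _) h1)
    have h6 : star a * a * (1 - e) = c * (1 - e) - (c - star a * a) * (1 - e) := by
      rw [sub_mul]; abel
    have h7 : ‖c * (1 - e)‖ ≤ ‖c‖ :=
      (norm_mul_le _ _).trans (mul_le_of_le_one_right (norm_nonneg _) h1)
    have h8 := norm_sub_le (c * (1 - e)) ((c - star a * a) * (1 - e))
    rw [← h6] at h8
    have h9 := mul_le_mul h4 h4 (norm_nonneg _) (norm_nonneg _)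
    linarith

instance : CStarAlgebra J.Quotient where

/-- The quotient map `A → A / J`. -/
def proj : A →⋆ₐ[ℂ] J.Quotient := { J.mkₐ with map_star' := fun a => (J.star_mkₐ a).symm }

lemma proj_surjective : Function.Surjective J.proj := J.mkₐ_surjective

lemma proj_eq_zero_iff {a : A} : J.proj a = 0 ↔ a ∈ J.toIdeal := Ideal.Quotient.eq_zero_iff_mem

/-- The closed two-sided ideal generated by a set: the smallest one containing it. -/
def span (s : Set A) : ClosedIdeal A where
  toIdeal := sInf {I : Ideal A | I.IsTwoSided ∧ IsClosed (I : Set A) ∧ s ⊆ I}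
  isTwoSided := ⟨fun b ha => by
    rw [Submodule.mem_sInf] at ha ⊢
    intro I hI
    have := hI.1
    exact Ideal.mul_mem_right (I := I) b (ha I hI)⟩
  isClosed := by
    rw [Submodule.coe_sInf]
    exact isClosed_biInter fun I hI => hI.2.1

lemma subset_span (s : Set A) : s ⊆ (span s).toIdeal := fun a ha => by
  change a ∈ sInf {I : Ideal A | I.IsTwoSided ∧ IsClosed (I : Set A) ∧ s ⊆ I}
  rw [Submodule.mem_sInf]
  exact fun I hI => hI.2.2 ha

lemma span_le {s : Set A} {J : ClosedIdeal A} (h : s ⊆ J.toIdeal) :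
    (span s).toIdeal ≤ J.toIdeal :=
  sInf_le ⟨J.isTwoSided, J.isClosed, h⟩

end ClosedIdeal

/-- A compact quantum group: a (nonzero) unital C⋆-algebra `A` with a coassociative unital
`⋆`-homomorphism `Δ : A → A ⊗ A` such that `Δ(A)(1 ⊗ A)` and `Δ(A)(A ⊗ 1)` span dense subspaces of
the minimal tensor product `A ⊗ A`. -/
structure CompactQuantumGroup (A : Type u) [CStarAlgebra A] where
  comul : A →⋆ₐ[ℂ] MinTensor A A
  nontrivial : Nontrivial A
  /-- `(Δ ⊗ id) Δ = (id ⊗ Δ) Δ` -/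
  coassoc : (MinTensor₃.tensorId A comul).comp comul = (MinTensor₃.idTensor A comul).comp comul
  dense_right : Dense (Submodule.span ℂ
    {x | ∃ a b : A, x = comul a * MinTensor.tmul 1 b} : Set (MinTensor A A))
  dense_left : Dense (Submodule.span ℂ
    {x | ∃ a b : A, x = comul a * MinTensor.tmul b 1} : Set (MinTensor A A))

namespace CompactQuantumGroup

variable {A : Type u} [CStarAlgebra A] (𝒢 : CompactQuantumGroup A)

/-- The counit is bounded: it is a unital `⋆`-homomorphism `ε : A → ℂ` defined on all of `A`, with
`(ε ⊗ id) Δ = id = (id ⊗ ε) Δ`. -/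
def HasBoundedCounit : Prop :=
  ∃ ε : A →⋆ₐ[ℂ] ℂ, (∀ a, MinTensor.sliceLeft ε (𝒢.comul a) = a) ∧
    ∀ a, MinTensor.sliceRight ε (𝒢.comul a) = a

/-- A Woronowicz C⋆-ideal: a proper closed two-sided ideal `I` of `A` with
`Δ(I) ⊆ ker (π ⊗ π)`, where `π : A → A / I` is the quotient map. -/
def IsWoronowiczIdeal (I : ClosedIdeal A) : Prop :=
  I.toIdeal ≠ ⊤ ∧ ∀ a ∈ I.toIdeal, MinTensor.map I.proj I.proj (𝒢.comul a) = 0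

/-- A quantum subgroup of `𝒢`: a compact quantum group whose algebra is a quotient `A / I`, such
that the quotient map `π : A → A / I` satisfies `(π ⊗ π) Δ = Δ_I π`. -/
structure QuantumSubgroup where
  ideal : ClosedIdeal A
  group : CompactQuantumGroup ideal.Quotient
  comul_proj : (MinTensor.map ideal.proj ideal.proj).comp 𝒢.comul = group.comul.comp ideal.proj

/-- An action of `𝒢` on a compact Hausdorff space `X`: a unital `⋆`-homomorphism
`α : C(X) → C(X) ⊗ A` with `(α ⊗ id) α = (id ⊗ Δ) α` such that `α(C(X))(1 ⊗ A)` spans a dense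
subspace of `C(X) ⊗ A`. -/
structure Action (X : Type u) [TopologicalSpace X] [CompactSpace X] [T2Space X] where
  coact : C(X, ℂ) →⋆ₐ[ℂ] MinTensor C(X, ℂ) A
  coact_comul : (MinTensor₃.tensorId A coact).comp coact =
    (MinTensor₃.idTensor C(X, ℂ) 𝒢.comul).comp coact
  dense : Dense (Submodule.span ℂ
    {x | ∃ (f : C(X, ℂ)) (a : A), x = coact f * MinTensor.tmul 1 a} : Set (MinTensor C(X, ℂ) A))

namespace Action

variable {𝒢} {X : Type u} [TopologicalSpace X] [CompactSpace X] [T2Space X] (α : 𝒢.Action X)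

/-- The induced coaction `α_H = (id ⊗ π_H) α` of a quantum subgroup `H`. -/
def restrict (H : 𝒢.QuantumSubgroup) : C(X, ℂ) →⋆ₐ[ℂ] MinTensor C(X, ℂ) H.ideal.Quotient :=
  (MinTensor.map (StarAlgHom.id ℂ C(X, ℂ)) H.ideal.proj).comp α.coact

/-- `H` fixes the subset `Y`: `(ev_y ⊗ id) α_H(f) = f(y) 1` for all `f ∈ C(X)`, `y ∈ Y`. -/
def Fixes (H : 𝒢.QuantumSubgroup) (Y : Set X) : Prop :=
  ∀ y ∈ Y, ∀ f : C(X, ℂ), MinTensor.sliceLeft (ContinuousMap.evalStarAlgHom ℂ ℂ y)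
    (α.restrict H f) = f y • (1 : H.ideal.Quotient)

/-- `H` is the stabilizer of `Y`: it fixes `Y`, and every quantum subgroup `K` fixing `Y` is a
quantum subgroup of `H`, i.e. the quotient map `A → A / I_K` factors as `ρ ∘ π_H` with an
epimorphism `ρ : A / I_H → A / I_K` such that `(ρ ⊗ ρ) Δ_H = Δ_K ρ`. -/
def IsStabilizer (H : 𝒢.QuantumSubgroup) (Y : Set X) : Prop :=
  α.Fixes H Y ∧ ∀ K : 𝒢.QuantumSubgroup, α.Fixes K Y →
    ∃ ρ : H.ideal.Quotient →⋆ₐ[ℂ] K.ideal.Quotient, Function.Surjective ρ ∧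
      ρ.comp H.ideal.proj = K.ideal.proj ∧
      (MinTensor.map ρ ρ).comp H.group.comul = K.group.comul.comp ρ

/-- The closed two-sided ideal of `A` generated by the elements `(ev_y ⊗ id) α(f) - f(y) 1` with
`f ∈ C(X)` and `y ∈ Y`. -/
def stabilizerIdeal (Y : Set X) : ClosedIdeal A :=
  ClosedIdeal.span {a | ∃ y ∈ Y, ∃ f : C(X, ℂ), a =
    MinTensor.sliceLeft (ContinuousMap.evalStarAlgHom ℂ ℂ y) (α.coact f) - f y • (1 : A)}

end Action

end CompactQuantumGroup

end CompactQuantum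

end

open CompactQuantum

/-!
Write `E y f = (ev_y ⊗ id) α(f)` for `y ∈ Y`, let `I` be the stabilizer ideal and `π : A → A / I`.

*`I` is proper.* Let `ε` be the bounded counit. The endomorphism `θ = (id ⊗ ε) α` of `C(X)`
satisfies `α θ = (α ⊗ ε) α = (id ⊗ (id ⊗ ε) Δ) α = α`, hence `θ θ = θ`; the density of
`α(C(X))(1 ⊗ A)` makes the range of `θ` dense, so `θ = id` (`Action.sliceRight_coact`). Therefore
`ε (E y f) = f(y)`, and `I` is contained in the kernel of `ε`, which does not contain `1`.

*`I` is a Woronowicz ideal.* The coaction identity gives `Δ(E y f) = (E y ⊗ id) α(f)`. If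
`q : A → B` satisfies `q (E y g) = g(y) 1` for all `g`, then
`(q ⊗ q) Δ(E y f) = 1 ⊗ q (E y f) = f(y) 1` (`Action.map_comul_orbitMap`). For `q = π` this says that
the generators of `I` lie in the closed ideal `ker ((π ⊗ π) Δ)`.

Thus `(π ⊗ π) Δ` descends to `A / I`; coassociativity and the density conditions pass to the quotient
because `π` and `π ⊗ π` have dense range (`IsWoronowiczIdeal.quantumSubgroup`). A quantum subgroup
`K` fixes `Y` exactly when its quotient map sends each `E y f` to `f(y) 1` (`Action.fixes_iff`), that
is, when `I ⊆ I_K`; this gives the universal property.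

Identities in minimal tensor products are checked in the representations `π ⊗ ρ`, which separate
points by construction. The slice map of a character `χ` enters through a representation by scalars
`χ(b) • 1`, since its tensor product with `ρ` is `1 ⊗ ρ((χ ⊗ id)(·))`.
-/

open scoped TensorProduct ENNReal

noncomputable section

namespace CompactQuantum

/-! ### Operators `S ⊗ 1` and `1 ⊗ T` -/

section Operators

variable {H K : Type u} [NormedAddCommGroup H] [InnerProductSpace ℂ H]
  [NormedAddCommGroup K] [InnerProductSpace ℂ K]

lemma norm_hilbertTensor_tmul (ξ : H) (η : K) : ‖HilbertTensor.tmul ξ η‖ = ‖ξ‖ * ‖η‖ := by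
  rw [HilbertTensor.tmul, LinearIsometry.norm_map, TensorProduct.norm_tmul]

lemma conj_opRight_smul_one {L : Type u} [NormedAddCommGroup L] [InnerProductSpace ℂ L]
    [CompleteSpace H] [CompleteSpace L] (c : ℂ) :
    hilbertAssoc.conjStarAlgEquiv (opRight (HilbertTensor H K) L (c • 1)) =
      opRight H (HilbertTensor K L) (c • 1) := by
  rw [← Algebra.algebraMap_eq_smul_one, ← Algebra.algebraMap_eq_smul_one, AlgHomClass.commutes,
    AlgHomClass.commutes]
  exact (AlgHomClass.commutes (opRight H (HilbertTensor K L)) c).symm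

variable [CompleteSpace H] [CompleteSpace K]

lemma opLeft_injective [Nontrivial K] : Function.Injective (opLeft H K) := by
  refine (injective_iff_map_eq_zero _).2 fun S hS => ContinuousLinearMap.ext fun ξ => ?_
  obtain ⟨η, hη⟩ := exists_ne (0 : K)
  have h : HilbertTensor.tmul (S ξ) η = 0 :=
    (opTensor_tmul S 1 ξ η).symm.trans (DFunLike.congr_fun hS (HilbertTensor.tmul ξ η))
  have h2 := norm_hilbertTensor_tmul (S ξ) η
  rw [h, norm_zero, eq_comm, mul_eq_zero, norm_eq_zero, norm_eq_zero] at h2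
  exact h2.resolve_right hη

lemma opRight_injective [Nontrivial H] : Function.Injective (opRight H K) := by
  refine (injective_iff_map_eq_zero _).2 fun T hT => ContinuousLinearMap.ext fun η => ?_
  obtain ⟨ξ, hξ⟩ := exists_ne (0 : H)
  have h : HilbertTensor.tmul ξ (T η) = 0 :=
    (opTensor_tmul 1 T ξ η).symm.trans (DFunLike.congr_fun hT (HilbertTensor.tmul ξ η))
  have h2 := norm_hilbertTensor_tmul ξ (T η)
  rw [h, norm_zero, eq_comm, mul_eq_zero, norm_eq_zero, norm_eq_zero] at h2
  exact h2.resolve_left hξ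

end Operators

/-! ### Slice maps and representations by scalars -/

/-- The representation `b ↦ χ b • 1` of `B` on the space of a given representation; only the Hilbert
space of the latter is used. -/
def HilbertRep.scalar {A B : Type u} [CStarAlgebra A] [CStarAlgebra B] (π : HilbertRep A)
    (χ : B →⋆ₐ[ℂ] ℂ) : HilbertRep B where
  space := π.space
  hom := MinTensor.scalarHom _ χ

namespace MinTensor

variable {A B C D : Type u} [CStarAlgebra A] [CStarAlgebra B] [CStarAlgebra C] [CStarAlgebra D]

lemma starAlgHom_ext {F : Type*} [CStarAlgebra F] {f g : MinTensor A B →⋆ₐ[ℂ] F}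
    (h : ∀ a b, f (tmul a b) = g (tmul a b)) : f = g := by
  refine StarAlgHom.ext fun x => congrFun ((denseRange_of A B).equalizer (starAlgHom_continuous f)
    (starAlgHom_continuous g) (funext fun t => ?_)) x
  change f (of A B t) = g (of A B t)
  induction t with
  | zero => simp only [map_zero]
  | add x y hx hy => simp only [map_add, hx, hy]
  | tmul a b => exact h a b

lemma rep_eq_opRight_sliceLeft (χ : B →⋆ₐ[ℂ] ℂ) (σ : HilbertRep B) (ρ : HilbertRep A)
    (hσ : ∀ b, σ.hom b = χ b • 1) (x : MinTensor B A) :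
    rep σ ρ x = opRight σ.space ρ.space (ρ.hom (sliceLeft χ x)) := by
  refine DFunLike.congr_fun (f := rep σ ρ)
    (g := ((opRight σ.space ρ.space).comp ρ.hom).comp (sliceLeft χ)) (starAlgHom_ext fun b a => ?_) x
  refine (rep_tmul σ ρ b a).trans ?_
  rw [hσ, opTensor_smul_left]
  change _ = opRight σ.space ρ.space (ρ.hom (sliceLeft χ (tmul b a)))
  rw [sliceLeft_tmul, map_smul, map_smul]
  rfl

lemma rep_eq_opLeft_sliceRight (χ : B →⋆ₐ[ℂ] ℂ) (ρ : HilbertRep A) (σ : HilbertRep B)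
    (hσ : ∀ b, σ.hom b = χ b • 1) (x : MinTensor A B) :
    rep ρ σ x = opLeft ρ.space σ.space (ρ.hom (sliceRight χ x)) := by
  refine DFunLike.congr_fun (f := rep ρ σ)
    (g := ((opLeft ρ.space σ.space).comp ρ.hom).comp (sliceRight χ)) (starAlgHom_ext fun a b => ?_) x
  refine (rep_tmul ρ σ a b).trans ?_
  rw [hσ, opTensor_smul_right]
  change _ = opLeft ρ.space σ.space (ρ.hom (sliceRight χ (tmul a b)))
  rw [sliceRight_tmul, map_smul, map_smul]
  rfl

/-- The representation `π ⊗ (ρ ⊗ 1)` is unitarily equivalent to `(π ⊗ ρ) ⊗ 1`. -/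
lemma rep_eq_conj_opLeft (π : HilbertRep B) (ρ : HilbertRep A) {L : Type u} [NormedAddCommGroup L]
    [InnerProductSpace ℂ L] [CompleteSpace L] [Nontrivial L]
    (g : A →⋆ₐ[ℂ] (HilbertTensor ρ.space L →L[ℂ] HilbertTensor ρ.space L))
    (hg : ∀ a, g a = opLeft ρ.space L (ρ.hom a)) (x : MinTensor B A) :
    rep π ⟨HilbertTensor ρ.space L, g⟩ x =
      hilbertAssoc.conjStarAlgEquiv (opLeft (HilbertTensor π.space ρ.space) L (rep π ρ x)) := by
  refine DFunLike.congr_fun (f := rep π ⟨HilbertTensor ρ.space L, g⟩)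
    (g := hilbertAssoc.conjStarAlgEquiv.toStarAlgHom.comp
      ((opLeft (HilbertTensor π.space ρ.space) L).comp (rep π ρ)))
    (starAlgHom_ext fun b a => ?_) x
  refine (rep_tmul π ⟨HilbertTensor ρ.space L, g⟩ b a).trans ?_
  refine Eq.trans ?_ (congrArg (fun T => hilbertAssoc.conjStarAlgEquiv
    (opLeft (HilbertTensor π.space ρ.space) L T)) (rep_tmul π ρ b a)).symm
  refine Eq.trans ?_ (conj_hilbertAssoc_opTensor (π.hom b) (ρ.hom a) (1 : L →L[ℂ] L)).symm
  exact congrArg (opTensor (π.hom b)) (hg a)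

lemma sliceLeft_map_id (χ : B →⋆ₐ[ℂ] ℂ) (g : A →⋆ₐ[ℂ] C) (x : MinTensor B A) :
    sliceLeft χ (map (StarAlgHom.id ℂ B) g x) = g (sliceLeft χ x) := by
  refine DFunLike.congr_fun (f := (sliceLeft χ).comp (map (StarAlgHom.id ℂ B) g))
    (g := g.comp (sliceLeft χ)) (starAlgHom_ext fun b a => ?_) x
  change sliceLeft χ (map (StarAlgHom.id ℂ B) g (tmul b a)) = g (sliceLeft χ (tmul b a))
  rw [map_tmul, sliceLeft_tmul, sliceLeft_tmul, map_smul]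
  rfl

/-- Slicing in either order gives `χ ⊗ ψ`. -/
lemma apply_sliceLeft (χ : B →⋆ₐ[ℂ] ℂ) (ψ : A →⋆ₐ[ℂ] ℂ) (x : MinTensor B A) :
    ψ (sliceLeft χ x) = χ (sliceRight ψ x) := by
  refine DFunLike.congr_fun (f := ψ.comp (sliceLeft χ))
    (g := χ.comp (sliceRight ψ)) (starAlgHom_ext fun b a => ?_) x
  change ψ (sliceLeft χ (tmul b a)) = χ (sliceRight ψ (tmul b a))
  rw [sliceLeft_tmul, sliceRight_tmul, map_smul, map_smul, smul_eq_mul, smul_eq_mul, mul_comm]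

lemma denseRange_map {f : A →⋆ₐ[ℂ] C} {g : B →⋆ₐ[ℂ] D} (hf : Function.Surjective f)
    (hg : Function.Surjective g) : DenseRange (map f g) := by
  refine (denseRange_of C D).mono ?_
  rintro _ ⟨t, rfl⟩
  induction t with
  | zero => exact ⟨0, by rw [map_zero, map_zero]⟩
  | add x y hx hy =>
    obtain ⟨a, ha⟩ := hx
    obtain ⟨b, hb⟩ := hy
    exact ⟨a + b, by rw [map_add, map_add, ha, hb]⟩
  | tmul c d =>
    obtain ⟨a, rfl⟩ := hf c
    obtain ⟨b, rfl⟩ := hg d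
    exact ⟨tmul a b, map_tmul f g a b⟩

lemma map_map {A' B' : Type u} [CStarAlgebra A'] [CStarAlgebra B'] (f : A →⋆ₐ[ℂ] C)
    (g : B →⋆ₐ[ℂ] D) (f' : C →⋆ₐ[ℂ] A') (g' : D →⋆ₐ[ℂ] B') (x : MinTensor A B) :
    map f' g' (map f g x) = map (f'.comp f) (g'.comp g) x := rfl

end MinTensor

/-! ### Homomorphisms from quotients by closed ideals -/

namespace ClosedIdeal

variable {A : Type u} [CStarAlgebra A]

/-- The factorization of a `⋆`-homomorphism vanishing on `J` through `A / J`. -/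
def lift (J : ClosedIdeal A) {F : Type*} [CStarAlgebra F] (f : A →⋆ₐ[ℂ] F)
    (hf : ∀ a ∈ J.toIdeal, f a = 0) : J.Quotient →⋆ₐ[ℂ] F :=
  { (Ideal.Quotient.liftₐ J.toIdeal f.toAlgHom hf : J.Quotient →ₐ[ℂ] F) with
    map_star' := fun x => by
      obtain ⟨a, rfl⟩ := J.proj_surjective x
      rw [← map_star]
      exact map_star f a }

/-- The kernel of a `⋆`-homomorphism. -/
def ker {F : Type*} [CStarAlgebra F] (f : A →⋆ₐ[ℂ] F) : ClosedIdeal A where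
  toIdeal := RingHom.ker f
  isTwoSided := inferInstance
  isClosed := isClosed_singleton.preimage (starAlgHom_continuous f)

lemma span_le_ker {F : Type*} [CStarAlgebra F] {s : Set A} (f : A →⋆ₐ[ℂ] F)
    (h : ∀ a ∈ s, f a = 0) : ∀ a ∈ (span s).toIdeal, f a = 0 :=
  span_le (J := ker f) h

end ClosedIdeal

namespace CompactQuantumGroup

variable {A : Type u} [CStarAlgebra A] {𝒢 : CompactQuantumGroup A}

/-! ### The quantum subgroup of a Woronowicz ideal -/

/-- Coassociativity passes along a homomorphism intertwining two comultiplications. -/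
lemma coassoc_apply_of_comp {B : Type u} [CStarAlgebra B] (q : A →⋆ₐ[ℂ] B)
    (Δ : B →⋆ₐ[ℂ] MinTensor B B) (hΔ : Δ.comp q = (MinTensor.map q q).comp 𝒢.comul) (a : A) :
    MinTensor₃.tensorId B Δ (Δ (q a)) = MinTensor₃.idTensor B Δ (Δ (q a)) := by
  have h1 : Δ (q a) = MinTensor.map q q (𝒢.comul a) := DFunLike.congr_fun hΔ a
  have hpull : ∀ π ρ : HilbertRep B, (MinTensor.rep π ρ).comp (Δ.comp q) =
      (MinTensor.rep (π.comp q) (ρ.comp q)).comp 𝒢.comul := fun π ρ =>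
    congrArg (fun f => (MinTensor.rep π ρ).comp f) hΔ
  refine MinTensor₃.ext_rep fun π ρ δ => ?_
  rw [MinTensor₃.rep_tensorId, MinTensor₃.rep_idTensor, h1, MinTensor.rep_map, MinTensor.rep_map]
  have h2 := congrArg (MinTensor₃.rep (π.comp q) (ρ.comp q) (δ.comp q))
    (DFunLike.congr_fun 𝒢.coassoc a)
  change MinTensor₃.rep _ _ _ (MinTensor₃.tensorId A 𝒢.comul (𝒢.comul a)) =
    MinTensor₃.rep _ _ _ (MinTensor₃.idTensor A 𝒢.comul (𝒢.comul a)) at h2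
  rw [MinTensor₃.rep_tensorId, MinTensor₃.rep_idTensor] at h2
  let E := HilbertTensor π.space (HilbertTensor ρ.space δ.space)
  let L (f : A →⋆ₐ[ℂ] (HilbertTensor π.space ρ.space →L[ℂ] HilbertTensor π.space ρ.space)) :
      E →L[ℂ] E :=
    hilbertAssoc.conjStarAlgEquiv (MinTensor.rep ⟨HilbertTensor π.space ρ.space, f⟩ (δ.comp q)
      (𝒢.comul a))
  let R (f : A →⋆ₐ[ℂ] (HilbertTensor ρ.space δ.space →L[ℂ] HilbertTensor ρ.space δ.space)) :
      E →L[ℂ] E :=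
    MinTensor.rep (π.comp q) ⟨HilbertTensor ρ.space δ.space, f⟩ (𝒢.comul a)
  exact (congrArg L (hpull π ρ)).trans (Eq.trans h2 (congrArg R (hpull ρ δ)).symm)

/-- The quantum subgroup with algebra `A / I`, for a Woronowicz ideal `I`: the comultiplication is
the factorization of `(π ⊗ π) Δ` through `A / I`. -/
def IsWoronowiczIdeal.quantumSubgroup {I : ClosedIdeal A} (hI : 𝒢.IsWoronowiczIdeal I) :
    𝒢.QuantumSubgroup where
  ideal := I
  group :=
    { comul := I.lift ((MinTensor.map I.proj I.proj).comp 𝒢.comul) hI.2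
      nontrivial := Ideal.Quotient.nontrivial_iff.2 hI.1
      coassoc := StarAlgHom.ext fun x => by
        obtain ⟨a, rfl⟩ := I.proj_surjective x
        exact coassoc_apply_of_comp I.proj _ rfl a
      dense_right := by
        refine ((MinTensor.denseRange_map I.proj_surjective I.proj_surjective).dense_image
          (starAlgHom_continuous _) 𝒢.dense_right).mono ?_
        rintro _ ⟨x, hx, rfl⟩
        induction hx using Submodule.span_induction with
        | mem x hx =>
          obtain ⟨a, b, rfl⟩ := hx
          refine Submodule.subset_span ⟨I.proj a, I.proj b, ?_⟩
          rw [map_mul, MinTensor.map_tmul, map_one]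
          rfl
        | zero => rw [map_zero]; exact zero_mem _
        | add x y _ _ hx hy => rw [map_add]; exact add_mem hx hy
        | smul c x _ hx => rw [map_smul]; exact Submodule.smul_mem _ c hx
      dense_left := by
        refine ((MinTensor.denseRange_map I.proj_surjective I.proj_surjective).dense_image
          (starAlgHom_continuous _) 𝒢.dense_left).mono ?_
        rintro _ ⟨x, hx, rfl⟩
        induction hx using Submodule.span_induction with
        | mem x hx =>
          obtain ⟨a, b, rfl⟩ := hx
          refine Submodule.subset_span ⟨I.proj a, I.proj b, ?_⟩
          rw [map_mul, MinTensor.map_tmul, map_one]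
          rfl
        | zero => rw [map_zero]; exact zero_mem _
        | add x y _ _ hx hy => rw [map_add]; exact add_mem hx hy
        | smul c x _ hx => rw [map_smul]; exact Submodule.smul_mem _ c hx }
  comul_proj := rfl

/-! ### Quantum subgroups fixing a set -/

namespace Action

variable {X : Type u} [TopologicalSpace X] [CompactSpace X] [T2Space X] (α : 𝒢.Action X)

/-- The `⋆`-homomorphism `f ↦ (ev_y ⊗ id) α(f)`, dual to the orbit map `g ↦ y g`. -/
def orbitMap (y : X) : C(X, ℂ) →⋆ₐ[ℂ] A :=
  (MinTensor.sliceLeft (ContinuousMap.evalStarAlgHom ℂ ℂ y)).comp α.coact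

/-- The coaction identity in a representation. -/
lemma conj_rep_coact_coact (π : HilbertRep C(X, ℂ)) (ρ σ : HilbertRep A) (f : C(X, ℂ)) :
    hilbertAssoc.conjStarAlgEquiv
      (MinTensor.rep (MinTensor.pullRep π ρ α.coact) σ (α.coact f)) =
      MinTensor.rep π (MinTensor.pullRep ρ σ 𝒢.comul) (α.coact f) :=
  congrArg (MinTensor₃.rep π ρ σ) (DFunLike.congr_fun α.coact_comul f)

/-- In the presence of a bounded counit `ε` the density condition on an action forces
`(id ⊗ ε) α = id`. -/
lemma sliceRight_coact (ε : A →⋆ₐ[ℂ] ℂ) (hε : ∀ a, MinTensor.sliceRight ε (𝒢.comul a) = a)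
    (f : C(X, ℂ)) : MinTensor.sliceRight ε (α.coact f) = f := by
  have hcoact : ∀ f, α.coact (MinTensor.sliceRight ε (α.coact f)) = α.coact f := fun f => by
    refine MinTensor.ext_rep fun π ρ => ?_
    have hσ : ∀ a, (ρ.scalar ε).hom a = ε a • 1 := fun a => Algebra.algebraMap_eq_smul_one (ε a)
    have h := α.conj_rep_coact_coact π ρ (ρ.scalar ε) f
    rw [MinTensor.rep_eq_opLeft_sliceRight ε _ _ hσ] at h
    refine opLeft_injective (K := ρ.space)
      (hilbertAssoc.conjStarAlgEquiv.injective (h.trans ?_))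
    refine MinTensor.rep_eq_conj_opLeft π ρ _ (fun a => ?_) (α.coact f)
    refine (MinTensor.rep_eq_opLeft_sliceRight ε ρ (ρ.scalar ε) hσ (𝒢.comul a)).trans ?_
    rw [hε]
  let θ : C(X, ℂ) →⋆ₐ[ℂ] C(X, ℂ) := (MinTensor.sliceRight ε).comp α.coact
  have hsurj : Function.Surjective (MinTensor.sliceRight (A := C(X, ℂ)) ε) := fun f =>
    ⟨MinTensor.tmul f 1, by rw [MinTensor.sliceRight_tmul, map_one, one_smul]⟩
  have hdense : DenseRange θ := by
    refine (hsurj.denseRange.dense_image (starAlgHom_continuous _) α.dense).mono ?_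
    rintro _ ⟨x, hx, rfl⟩
    induction hx using Submodule.span_induction with
    | mem x hx =>
      obtain ⟨f, a, rfl⟩ := hx
      refine ⟨ε a • f, ?_⟩
      rw [map_mul, MinTensor.sliceRight_tmul, mul_smul_comm, mul_one, map_smul]
      rfl
    | zero => exact ⟨0, by rw [map_zero, map_zero]⟩
    | add x y _ _ hx hy =>
      obtain ⟨a, ha⟩ := hx
      obtain ⟨b, hb⟩ := hy
      exact ⟨a + b, by rw [map_add, map_add, ha, hb]⟩
    | smul c x _ hx =>
      obtain ⟨a, ha⟩ := hx
      exact ⟨c • a, by rw [map_smul, map_smul, ha]⟩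
  exact congrFun (hdense.equalizer (starAlgHom_continuous θ) continuous_id
    (funext fun f => congrArg (MinTensor.sliceRight ε) (hcoact f))) f

lemma counit_orbitMap (ε : A →⋆ₐ[ℂ] ℂ) (hε : ∀ a, MinTensor.sliceRight ε (𝒢.comul a) = a)
    (y : X) (f : C(X, ℂ)) : ε (α.orbitMap y f) = f y := by
  refine (MinTensor.apply_sliceLeft _ ε (α.coact f)).trans ?_
  rw [α.sliceRight_coact ε hε]
  rfl

/-- From `Δ(E f) = (E ⊗ id) α(f)`, where `E = (ev_y ⊗ id) α`: a homomorphism `q` that sends every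
`E g` to the scalar `g(y)` has `(q ⊗ q) Δ(E f) = f(y) 1`. -/
lemma map_comul_orbitMap {B : Type u} [CStarAlgebra B] (q : A →⋆ₐ[ℂ] B) {y : X}
    (hq : ∀ g, q (α.orbitMap y g) = g y • 1) (f : C(X, ℂ)) :
    MinTensor.map q q (𝒢.comul (α.orbitMap y f)) = f y • 1 := by
  refine MinTensor.ext_rep fun σ τ => ?_
  let χ : C(X, ℂ) →⋆ₐ[ℂ] ℂ := ContinuousMap.evalStarAlgHom ℂ ℂ y
  have hδ : ∀ g, (σ.scalar χ).hom g = χ g • 1 := fun g => Algebra.algebraMap_eq_smul_one (χ g)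
  have h := α.conj_rep_coact_coact (σ.scalar χ) (σ.comp q) (τ.comp q) f
  -- The representation `(χ ⊗ σ q) α` is again by the scalars `g(y)`, by the hypothesis on `q`.
  have hpull : ∀ g, (MinTensor.pullRep (σ.scalar χ) (σ.comp q) α.coact).hom g = χ g • 1 := fun g => by
    refine (MinTensor.rep_eq_opRight_sliceLeft χ _ (σ.comp q) hδ (α.coact g)).trans ?_
    have h1 : (σ.comp q).hom (MinTensor.sliceLeft χ (α.coact g)) = χ g • 1 := by
      refine (congrArg σ.hom (hq g)).trans ?_
      rw [map_smul, map_one]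
      rfl
    rw [h1, map_smul, map_one]
    rfl
  rw [MinTensor.rep_eq_opRight_sliceLeft χ _ _ hpull,
    MinTensor.rep_eq_opRight_sliceLeft χ _ _ hδ] at h
  have h2 : (τ.comp q).hom (MinTensor.sliceLeft χ (α.coact f)) = f y • 1 := by
    refine (congrArg τ.hom (hq f)).trans ?_
    rw [map_smul, map_one]
    rfl
  let L (T : τ.space →L[ℂ] τ.space) : HilbertTensor σ.space (HilbertTensor σ.space τ.space) →L[ℂ]
      HilbertTensor σ.space (HilbertTensor σ.space τ.space) :=
    hilbertAssoc.conjStarAlgEquiv (opRight (HilbertTensor σ.space σ.space) τ.space T)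
  have h3 : L ((τ.comp q).hom (MinTensor.sliceLeft χ (α.coact f))) =
      opRight σ.space (HilbertTensor σ.space τ.space)
        ((MinTensor.pullRep (σ.comp q) (τ.comp q) 𝒢.comul).hom
          (MinTensor.sliceLeft χ (α.coact f))) := h
  rw [h2] at h3
  rw [map_smul, map_one]
  exact opRight_injective (h3.symm.trans (conj_opRight_smul_one (f y)))

lemma proj_orbitMap {Y : Set X} {y : X} (hy : y ∈ Y) (f : C(X, ℂ)) :
    (α.stabilizerIdeal Y).proj (α.orbitMap y f) = f y • 1 := by
  have h : α.orbitMap y f - f y • 1 ∈ (α.stabilizerIdeal Y).toIdeal :=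
    ClosedIdeal.subset_span _ ⟨y, hy, f, rfl⟩
  rw [← ClosedIdeal.proj_eq_zero_iff, map_sub, map_smul, map_one] at h
  exact sub_eq_zero.1 h

lemma eq_zero_of_mem_stabilizerIdeal {Y : Set X} {F : Type*} [CStarAlgebra F] (q : A →⋆ₐ[ℂ] F)
    (hq : ∀ y ∈ Y, ∀ f, q (α.orbitMap y f) = f y • 1) {a : A}
    (ha : a ∈ (α.stabilizerIdeal Y).toIdeal) : q a = 0 := by
  refine ClosedIdeal.span_le_ker q ?_ a ha
  rintro _ ⟨y, hy, f, rfl⟩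
  rw [map_sub, map_smul, map_one, sub_eq_zero]
  exact hq y hy f

lemma fixes_iff (K : 𝒢.QuantumSubgroup) (Y : Set X) :
    α.Fixes K Y ↔ ∀ y ∈ Y, ∀ f, K.ideal.proj (α.orbitMap y f) = f y • 1 :=
  forall₃_congr fun _ _ f => by
    rw [show MinTensor.sliceLeft _ (α.restrict K f) = K.ideal.proj (α.orbitMap _ f) from
      MinTensor.sliceLeft_map_id _ K.ideal.proj (α.coact f)]

lemma isWoronowiczIdeal_stabilizerIdeal (h𝒢 : 𝒢.HasBoundedCounit) (Y : Set X) :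
    𝒢.IsWoronowiczIdeal (α.stabilizerIdeal Y) := by
  obtain ⟨ε, -, hε⟩ := h𝒢
  refine ⟨fun h => ?_, fun a ha => ?_⟩
  · have h1 : ε 1 = 0 := α.eq_zero_of_mem_stabilizerIdeal (Y := Y) ε
      (fun y _ f => by rw [α.counit_orbitMap ε hε, smul_eq_mul, mul_one]) (h ▸ Submodule.mem_top)
    exact one_ne_zero ((map_one ε).symm.trans h1)
  · exact α.eq_zero_of_mem_stabilizerIdeal
      ((MinTensor.map (α.stabilizerIdeal Y).proj (α.stabilizerIdeal Y).proj).comp 𝒢.comul)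
      (fun y hy f => α.map_comul_orbitMap _ (α.proj_orbitMap hy) f) ha

/-- A quantum subgroup with ideal `I_Y` is the stabilizer of `Y`. -/
lemma isStabilizer_of_ideal_eq (H : 𝒢.QuantumSubgroup) {Y : Set X}
    (hH : H.ideal = α.stabilizerIdeal Y) : α.IsStabilizer H Y := by
  refine ⟨(α.fixes_iff H Y).2 fun y hy f => ?_, fun K hK => ?_⟩
  · rw [hH]
    exact α.proj_orbitMap hy f
  · let ρ : H.ideal.Quotient →⋆ₐ[ℂ] K.ideal.Quotient := H.ideal.lift K.ideal.proj fun a ha =>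
      α.eq_zero_of_mem_stabilizerIdeal _ ((α.fixes_iff K Y).1 hK) (hH ▸ ha)
    have hρ : ρ.comp H.ideal.proj = K.ideal.proj := rfl
    refine ⟨ρ, fun x => ?_, hρ, StarAlgHom.ext fun x => ?_⟩
    · obtain ⟨a, rfl⟩ := K.ideal.proj_surjective x
      exact ⟨H.ideal.proj a, rfl⟩
    · obtain ⟨a, rfl⟩ := H.ideal.proj_surjective x
      have h1 : H.group.comul (H.ideal.proj a) =
          MinTensor.map H.ideal.proj H.ideal.proj (𝒢.comul a) :=
        (DFunLike.congr_fun H.comul_proj a).symm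
      change MinTensor.map ρ ρ (H.group.comul (H.ideal.proj a)) = K.group.comul (K.ideal.proj a)
      rw [h1, MinTensor.map_map, hρ]
      exact DFunLike.congr_fun K.comul_proj a

end Action

end CompactQuantumGroup

end CompactQuantum

end

open CompactQuantum
theorem mainTheorem1 {A X : Type u} [CStarAlgebra A] (𝒢 : CompactQuantumGroup A)
    (h𝒢 : 𝒢.HasBoundedCounit) [TopologicalSpace X] [CompactSpace X] [T2Space X]
    (α : 𝒢.Action X) (Y : Set X) :
    𝒢.IsWoronowiczIdeal (α.stabilizerIdeal Y) ∧
    ∃ H : 𝒢.QuantumSubgroup, H.ideal = α.stabilizerIdeal Y ∧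
      α.Fixes H Y ∧ α.IsStabilizer H Y := by
  have hI := α.isWoronowiczIdeal_stabilizerIdeal h𝒢 Y
  have hH := α.isStabilizer_of_ideal_eq hI.quantumSubgroup rfl
  exact ⟨hI, hI.quantumSubgroup, rfl, hH.1, hH⟩
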